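/- Let $U,V$ be linear subspaces of the Euclidean space $\mathbb{R}^n$ with $U\neq U\cap V$ and $U\cap V\neq\{0\}$, and let $\alpha\in(0,1]$, $\beta\in(0,1)$. Write $P_W$ for the matrix of the orthogonal projector onto a subspace $W$, and let $\theta_F\in(0,\frac{\pi}{2}]$ be the Friedrichs angle between $U$ and $V$, i.e. the angle whose cosine is $$c_F:=\cos\theta_F=\sup\{\langle u,v\rangle : u\in U\cap(U\cap V)^\perp,\ v\in V\cap(U\cap V)^\perp,\ \|u\|\le 1,\ \|v\|\le 1\}.$$ For $A\in\mathbb{C}^{n\times n}$ with spectrum $\sigma(A)$, let $\gamma(A):=\max\{|\lambda| : \lambda\in\{0\}\cup(\sigma(A)\setminus\{1\})\}$. Say that $A$ is linearly convergent to $A^\infty\in\mathbb{C}^{n\times n}$ with rate $\mu\in[0,1)$ if there are a positive integer $k_0$ and some $M>0$ with $\|A^k-A^\infty\|\le M\mu^k$ for all $k\ge k_0$ (operator norm induced by the Euclidean norm); $\mu$ is then called a linear convergence rate of $A$. If the infimum of all linear convergence rates of $A$ is itself such a rate, it is called the optimal linear convergence rate of $A$. Then $\gamma(T_{\alpha,\beta})<1$,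 and the AAMR operator $$T_{\alpha,\beta}:=(1-\alpha)I+\alpha(2\beta P_V-I)(2\beta P_U-I)$$ is linearly convergent to $P_{U^\perp\cap V^\perp}$ with every rate $\mu\in(\gamma(T_{\alpha,\beta}),1)$, where $$\gamma(T_{\alpha,\beta})=\begin{cases} 1-4\alpha\beta(1-\beta), & \text{if } 0\le c_F<c(\alpha,\beta);\\ \sqrt{4(1-\alpha)\alpha\beta^2c_F^2+(1-2\alpha\beta)^2}, & \text{if } c(\alpha,\beta)\le c_F<\widehat{c}_\beta;\\ 1+2\alpha\beta\left(\beta c_F^2-1+c_F\sqrt{\beta^2c_F^2-2\beta+1}\right), & \text{if } \widehat{c}_\beta\le c_F<1, \end{cases}$$ with, writing $x^+:=\max\{0,x\}$, $$\widehat{c}_\beta:=\frac{\sqrt{(2\beta-1)^+}}{\beta},\qquad c(\alpha,\beta):=\begin{cases} \sqrt{\dfrac{\left((1-4\alpha\beta(1-\beta))^2-(1-2\alpha\beta)^2\right)^+}{4(1-\alpha)\alpha\beta^2}}, & \text{if } \alpha<1;\\ 0, & \text{if } \alpha=1. \end{cases}$$ Furthermore, $\gamma(T_{\alpha,\beta})$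 is the optimal linear convergence rate of $T_{\alpha,\beta}$ if and only if $\beta\neq\frac{1}{1+\sin\theta_F}$ or $\theta_F=\frac{\pi}{2}$. -/

import Mathlib

noncomputable section

namespace AAMR

/-- The matrix (in the standard basis of `ℝⁿ`) of the orthogonal projector onto `U`. -/
def projMatrix {n : ℕ} (U : Submodule ℝ (EuclideanSpace ℝ (Fin n))) :
    Matrix (Fin n) (Fin n) ℝ :=
  (Matrix.toEuclideanCLM (n := Fin n) (𝕜 := ℝ)).symm U.starProjection

/-- The AAMR operator `T_{U,V,α,β} = (1-α) I + α (2β P_V - I)(2β P_U - I)`. -/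
def operator {n : ℕ} (U V : Submodule ℝ (EuclideanSpace ℝ (Fin n))) (α β : ℝ) :
    Matrix (Fin n) (Fin n) ℝ :=
  (1 - α) • (1 : Matrix (Fin n) (Fin n) ℝ)
    + α • (((2 * β) • projMatrix V - 1) * ((2 * β) • projMatrix U - 1))

/-- A real matrix regarded as a complex one. -/
def toComplex {n : ℕ} (A : Matrix (Fin n) (Fin n) ℝ) : Matrix (Fin n) (Fin n) ℂ :=
  A.map Complex.ofReal

/-- The cosine of the Friedrichs angle:
`sup { ⟪u, v⟫ : u ∈ U ∩ (U ∩ V)ᗮ, v ∈ V ∩ (U ∩ V)ᗮ, ‖u‖ ≤ 1, ‖v‖ ≤ 1 }`. -/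
def friedrichsCos {n : ℕ} (U V : Submodule ℝ (EuclideanSpace ℝ (Fin n))) : ℝ :=
  sSup {t : ℝ | ∃ u ∈ U ⊓ (U ⊓ V)ᗮ, ∃ v ∈ V ⊓ (U ⊓ V)ᗮ,
    ‖u‖ ≤ 1 ∧ ‖v‖ ≤ 1 ∧ t = inner ℝ u v}

/-- The Friedrichs angle `θ_F` between `U` and `V`. -/
def friedrichsAngle {n : ℕ} (U V : Submodule ℝ (EuclideanSpace ℝ (Fin n))) : ℝ :=
  Real.arccos (friedrichsCos U V)

/-- `γ(A) = max { |λ| : λ ∈ {0} ∪ (σ(A) \ {1}) }`, with `σ(A)` the set of complex eigenvalues. -/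
def gamma {n : ℕ} (A : Matrix (Fin n) (Fin n) ℂ) : ℝ :=
  sSup ((fun z : ℂ => ‖z‖) '' ({0} ∪ (spectrum ℂ A \ {1})))

/-- The supremum in the definition of `gamma` is a maximum. -/
theorem gamma_isGreatest {n : ℕ} (A : Matrix (Fin n) (Fin n) ℂ) :
    IsGreatest ((fun z : ℂ => ‖z‖) '' ({0} ∪ (spectrum ℂ A \ {1}))) (gamma A) := by
  have hfin : ((fun z : ℂ => ‖z‖) '' ({0} ∪ (spectrum ℂ A \ {1}))).Finite :=
    (((Set.finite_singleton 0).union ((Matrix.finite_spectrum A).subset Set.sdiff_subset))).image _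
  have hne : ((fun z : ℂ => ‖z‖) '' ({0} ∪ (spectrum ℂ A \ {1}))).Nonempty :=
    ⟨‖(0 : ℂ)‖, 0, Or.inl rfl, rfl⟩
  exact ⟨hne.csSup_mem hfin, fun x hx => le_csSup hfin.bddAbove hx⟩

open scoped Matrix.Norms.L2Operator in
/-- `A` is linearly convergent to `B` with rate `μ ∈ [0,1)`; the norm is the operator norm
induced by the Euclidean norm of `ℂⁿ`. -/
def LinearlyConvergesTo {n : ℕ} (A B : Matrix (Fin n) (Fin n) ℂ) (μ : ℝ) : Prop :=
  0 ≤ μ ∧ μ < 1 ∧ ∃ k₀ : ℕ, 0 < k₀ ∧ ∃ M : ℝ, 0 < M ∧ ∀ k : ℕ, k₀ ≤ k → ‖A ^ k - B‖ ≤ M * μ ^ k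

/-- `μ` is a linear convergence rate of `A`. -/
def IsLinearRate {n : ℕ} (A : Matrix (Fin n) (Fin n) ℂ) (μ : ℝ) : Prop :=
  ∃ B : Matrix (Fin n) (Fin n) ℂ, LinearlyConvergesTo A B μ

/-- `μ` is the optimal linear convergence rate of `A`: the infimum of all linear convergence
rates, being itself such a rate. -/
def IsOptimalLinearRate {n : ℕ} (A : Matrix (Fin n) (Fin n) ℂ) (μ : ℝ) : Prop :=
  IsLeast {ν : ℝ | IsLinearRate A ν} μ

/-- The threshold `ĉ_β = √((2β-1)⁺) / β`. -/
def cHat (β : ℝ) : ℝ :=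
  Real.sqrt (max 0 (2 * β - 1)) / β

/-- The threshold `c(α,β)`. -/
def cThreshold (α β : ℝ) : ℝ :=
  if α < 1 then
    Real.sqrt (max 0 ((1 - 4 * α * β * (1 - β)) ^ 2 - (1 - 2 * α * β) ^ 2)
      / (4 * (1 - α) * α * β ^ 2))
  else 0

end AAMR

end

/-! The self-adjoint operator `C = cosSq U V` commutes with both projectors, so its eigenspaces are
invariant under the AAMR operator `T` and replace an explicit choice of principal vectors. For the
eigenvalue `t = 1` the eigenspace is the sum of `U ⊓ V`, where `T` is the scalar `κ = 1 - 4αβ(1-β)`,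
and `Uᗮ ⊓ Vᗮ`, where `T` is the identity. Every other `t` lies in `[0, c_F²]`, and `c_F²` is
attained (`exists_eigenvector_friedrichsCos`). There `T` satisfies `X² - 2mX + d = 0` with `m`, `d`
affine and nondecreasing in `t` (`aamrMap_aamrMap`). The roots for all `t ≤ c_F²` are bounded in
modulus by the radius `ρ` at `t = c_F²` (`norm_root_le_blockRadius`), so `γ(T) = max κ ρ`, which is
below `1`; the thresholds decide whether the roots are real and which term of the maximum wins.

Powers of `T` decay like powers of the roots unless a block is defective, which brings in a term `k
λ^k`. This requires a double root, that is `t = 0` or `discr β t = 0`. At `t = 0` the operator is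
still scalar, hence harmless; a double root at `0 < t < c_F²` has modulus strictly below `ρ`. Hence
`γ(T)` fails to be a rate exactly when `c_F ≠ 0` and `discr β (c_F²) = 0`, and the latter says `β =
1/(1 + sin θ_F)`. -/

namespace AAMR

/-! ### Invariant blocks of a pair of projectors -/

section Geometry

variable {E : Type*} [NormedAddCommGroup E] [InnerProductSpace ℝ E] [FiniteDimensional ℝ E]

/-- The operator `1 - (P_V - P_U)²`, which commutes with both projectors and whose eigenvalues
are the squared cosines of the principal angles between `U` and `V`. -/
noncomputable def cosSq (U V : Submodule ℝ E) : E →ₗ[ℝ] E :=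
  LinearMap.id - (V.starProjection - U.starProjection : E →L[ℝ] E).toLinearMap ∘ₗ
    (V.starProjection - U.starProjection : E →L[ℝ] E).toLinearMap

/-- The AAMR operator as a linear map. -/
noncomputable def aamrMap (U V : Submodule ℝ E) (α β : ℝ) : E →ₗ[ℝ] E :=
  (1 - α) • LinearMap.id +
    α • (((2 * β) • (V.starProjection : E →L[ℝ] E).toLinearMap - LinearMap.id) ∘ₗ
      ((2 * β) • (U.starProjection : E →L[ℝ] E).toLinearMap - LinearMap.id))

theorem starProjection_idem (U : Submodule ℝ E) (x : E) :
    U.starProjection (U.starProjection x) = U.starProjection x :=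
  Submodule.starProjection_eq_self_iff.2 (U.starProjection_apply_mem x)

theorem cosSq_apply (U V : Submodule ℝ E) (x : E) :
    cosSq U V x = x - V.starProjection x - U.starProjection x
      + V.starProjection (U.starProjection x) + U.starProjection (V.starProjection x) := by
  simp only [cosSq, LinearMap.sub_apply, LinearMap.id_apply, LinearMap.comp_apply,
    ContinuousLinearMap.coe_coe, _root_.sub_apply, map_sub, starProjection_idem]
  abel

theorem aamrMap_apply (U V : Submodule ℝ E) (α β : ℝ) (x : E) :
    aamrMap U V α β x = (1 - α) • x + α • ((2 * β) • V.starProjection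
      ((2 * β) • U.starProjection x - x) - ((2 * β) • U.starProjection x - x)) := by
  simp [aamrMap]

theorem cosSq_comm (U V : Submodule ℝ E) (x : E) : cosSq U V x = cosSq V U x := by
  simp only [cosSq_apply]; abel

theorem cosSq_isSymmetric (U V : Submodule ℝ E) : (cosSq U V).IsSymmetric := by
  intro x y
  simp only [cosSq_apply, inner_add_left, inner_sub_left, inner_add_right, inner_sub_right,
    Submodule.inner_starProjection_left_eq_right]
  ring

theorem starProjection_cosSq_right (U V : Submodule ℝ E) (x : E) :
    V.starProjection (cosSq U V x) =
      V.starProjection (U.starProjection (V.starProjection x)) := by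
  simp only [cosSq_apply, map_add, map_sub, starProjection_idem]; abel

theorem cosSq_starProjection_right (U V : Submodule ℝ E) (x : E) :
    cosSq U V (V.starProjection x) = V.starProjection (cosSq U V x) := by
  simp only [cosSq_apply, map_add, map_sub, starProjection_idem]; abel

theorem starProjection_cosSq_left (U V : Submodule ℝ E) (x : E) :
    U.starProjection (cosSq U V x) =
      U.starProjection (V.starProjection (U.starProjection x)) := by
  rw [cosSq_comm, starProjection_cosSq_right]

theorem cosSq_starProjection_left (U V : Submodule ℝ E) (x : E) :
    cosSq U V (U.starProjection x) = U.starProjection (cosSq U V x) := by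
  rw [cosSq_comm, cosSq_starProjection_right, cosSq_comm]

theorem cosSq_of_mem_left {U V : Submodule ℝ E} {x : E} (hx : x ∈ U) :
    cosSq U V x = U.starProjection (V.starProjection x) := by
  rw [cosSq_apply, Submodule.starProjection_eq_self_iff.2 hx]; abel

theorem cosSq_of_mem_inf {U V : Submodule ℝ E} {x : E} (hx : x ∈ U ⊓ V) : cosSq U V x = x := by
  rw [cosSq_of_mem_left hx.1, Submodule.starProjection_eq_self_iff.2 hx.2,
    Submodule.starProjection_eq_self_iff.2 hx.1]

theorem cosSq_of_mem_orthogonal_inf {U V : Submodule ℝ E} {x : E} (hx : x ∈ Uᗮ ⊓ Vᗮ) :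
    cosSq U V x = x := by
  have h1 := (Submodule.starProjection_apply_eq_zero_iff U).2 hx.1
  have h2 := (Submodule.starProjection_apply_eq_zero_iff V).2 hx.2
  simp [cosSq_apply, h1, h2]

/-- Eigenvectors of `cosSq` for eigenvalues other than `1` are orthogonal to its fixed points. -/
theorem inner_eq_zero_of_cosSq {U V : Submodule ℝ E} {t : ℝ} (ht : t ≠ 1) {x w : E}
    (hx : cosSq U V x = t • x) (hw : cosSq U V w = w) : inner ℝ w x = 0 := by
  have h := cosSq_isSymmetric U V w x
  rw [hx, hw, inner_smul_right] at h
  have : (1 - t) * inner ℝ w x = 0 := by linarith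
  rcases mul_eq_zero.1 this with h | h
  · exact absurd (by linarith) ht
  · exact h

/-- With `C = cosSq U V`, `⟪x, x - C x⟫ = ‖P_V x - P_U x‖²`. -/
theorem starProjection_eq_of_cosSq_eq_self {U V : Submodule ℝ E} {x : E}
    (hx : cosSq U V x = x) : V.starProjection x = U.starProjection x := by
  have h : inner ℝ (V.starProjection x - U.starProjection x)
      (V.starProjection x - U.starProjection x) = (0 : ℝ) := by
    have h1 : inner ℝ x (x - cosSq U V x) = (0 : ℝ) := by simp [hx]
    rw [← h1, cosSq_apply]
    simp only [inner_add_right, inner_sub_left, inner_sub_right,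
      Submodule.inner_starProjection_left_eq_right, starProjection_idem]
    ring
  exact sub_eq_zero.1 (inner_self_eq_zero.1 h)

/-- `‖P_U P_V x‖² = ⟪x, P_V P_U P_V x⟫ = ⟪x, P_V C x⟫` with `C = cosSq U V`. -/
theorem starProjection_starProjection_eq_zero_of_cosSq_eq_zero {U V : Submodule ℝ E} {x : E}
    (hx : cosSq U V x = 0) : U.starProjection (V.starProjection x) = 0 := by
  have h : inner ℝ (U.starProjection (V.starProjection x))
      (U.starProjection (V.starProjection x)) = (0 : ℝ) := by
    have h1 := starProjection_cosSq_right U V x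
    rw [hx, map_zero] at h1
    rw [Submodule.inner_starProjection_left_eq_right, starProjection_idem,
      Submodule.inner_starProjection_left_eq_right, ← h1, inner_zero_right]
  exact inner_self_eq_zero.1 h

/-- Both products of projectors kill `x`, so `x = P_V x + P_U x`. The quadratic has a double root at
`t = 0`, yet the block is scalar: this is why `θ_F = π/2` is no exception to optimality. -/
theorem aamrMap_of_cosSq_eq_zero {U V : Submodule ℝ E} {x : E} (α β : ℝ)
    (hx : cosSq U V x = 0) : aamrMap U V α β x = (1 - 2 * α * β) • x := by
  have h1 := starProjection_starProjection_eq_zero_of_cosSq_eq_zero hx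
  have h2 := starProjection_starProjection_eq_zero_of_cosSq_eq_zero ((cosSq_comm V U x).trans hx)
  have h3 : x = V.starProjection x + U.starProjection x := by
    rw [cosSq_apply, h1, h2] at hx
    have : x - V.starProjection x - U.starProjection x = 0 := by simpa using hx
    rw [sub_sub, sub_eq_zero] at this
    exact this
  rw [aamrMap_apply, map_sub, map_smul, h2]
  have h4 : U.starProjection x = x - V.starProjection x := eq_sub_of_add_eq' h3.symm
  rw [h4]
  module

theorem aamrMap_of_mem_inf {U V : Submodule ℝ E} {x : E} (α β : ℝ) (hx : x ∈ U ⊓ V) :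
    aamrMap U V α β x = (1 - 4 * α * β * (1 - β)) • x := by
  rw [aamrMap_apply, Submodule.starProjection_eq_self_iff.2 hx.1, map_sub, map_smul,
    Submodule.starProjection_eq_self_iff.2 hx.2]
  module

theorem aamrMap_of_mem_orthogonal_inf {U V : Submodule ℝ E} {x : E} (α β : ℝ)
    (hx : x ∈ Uᗮ ⊓ Vᗮ) : aamrMap U V α β x = x := by
  have h1 := (Submodule.starProjection_apply_eq_zero_iff U).2 hx.1
  have h2 := (Submodule.starProjection_apply_eq_zero_iff V).2 hx.2
  rw [aamrMap_apply, h1, map_sub, map_smul, h2]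
  simp
  module

/-- A fixed point of `cosSq` splits along `U ∩ V` and `Uᗮ ∩ Vᗮ`. -/
theorem exists_decomp_of_cosSq_eq_self {U V : Submodule ℝ E} {x : E} (hx : cosSq U V x = x) :
    V.starProjection x ∈ U ⊓ V ∧ x - V.starProjection x ∈ Uᗮ ⊓ Vᗮ := by
  have h := starProjection_eq_of_cosSq_eq_self hx
  refine ⟨⟨?_, V.starProjection_apply_mem x⟩, ?_, Submodule.sub_starProjection_mem_orthogonal x⟩
  · rw [h]; exact U.starProjection_apply_mem x
  · rw [h]; exact Submodule.sub_starProjection_mem_orthogonal x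

theorem starProjection_orthogonal_inf_of_cosSq_eq_self {U V : Submodule ℝ E} {x : E}
    (hx : cosSq U V x = x) :
    (Uᗮ ⊓ Vᗮ).starProjection x = x - V.starProjection x := by
  obtain ⟨h1, h2⟩ := exists_decomp_of_cosSq_eq_self hx
  refine Submodule.eq_starProjection_of_mem_orthogonal h2 ?_
  rw [sub_sub_cancel, Submodule.mem_orthogonal]
  intro w hw
  exact Submodule.inner_left_of_mem_orthogonal h1.2 hw.2

theorem starProjection_orthogonal_inf_of_ne_one {U V : Submodule ℝ E} {t : ℝ} (ht : t ≠ 1)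
    {x : E} (hx : cosSq U V x = t • x) : (Uᗮ ⊓ Vᗮ).starProjection x = 0 := by
  rw [Submodule.starProjection_apply_eq_zero_iff, Submodule.mem_orthogonal]
  intro w hw
  exact inner_eq_zero_of_cosSq ht hx (cosSq_of_mem_orthogonal_inf hw)

/-- On each eigenspace of `cosSq` the AAMR operator satisfies a quadratic equation. -/
theorem aamrMap_aamrMap {U V : Submodule ℝ E} {t : ℝ} {x : E} (α β : ℝ)
    (hx : cosSq U V x = t • x) :
    aamrMap U V α β (aamrMap U V α β x) =
      (2 * (1 - 2 * α * β + 2 * α * β ^ 2 * t)) • aamrMap U V α β x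
        - (4 * (1 - α) * α * β ^ 2 * t + (1 - 2 * α * β) ^ 2) • x := by
  -- The eigenvalue equation gives `P_U P_V P_U x = t P_U x` and eliminates `P_U P_V x`, so
  -- everything reduces to combinations of `x`, `P_U x`, `P_V x`, `P_V P_U x`.
  have hV := starProjection_cosSq_left U V x
  rw [hx, map_smul] at hV
  have hq : U.starProjection (V.starProjection x) =
      t • x - (x - V.starProjection x - U.starProjection x
        + V.starProjection (U.starProjection x)) := by
    rw [← hx, cosSq_apply]; abel
  simp only [aamrMap_apply, map_add, map_sub, map_smul, starProjection_idem, ← hV, hq]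
  module

/-- The AAMR operator is not scalar on the eigenspaces of `cosSq` for eigenvalues in `(0,1)`. -/
theorem aamrMap_starProjection_ne {U V : Submodule ℝ E} {α β t l : ℝ} (hα : α ≠ 0) (hβ : β ≠ 0)
    (h0 : t ≠ 0) (h1 : t ≠ 1) {u : E} (hu : u ∈ U) (hu0 : u ≠ 0) (hC : cosSq U V u = t • u) :
    aamrMap U V α β (V.starProjection u) ≠ l • V.starProjection u := by
  intro h
  rw [cosSq_of_mem_left hu] at hC
  rw [aamrMap_apply, hC, map_sub, map_smul, map_smul, starProjection_idem] at h
  -- If `P_V u` were an eigenvector, `u` would be a multiple of it, hence in `U ⊓ V`, forcing `t =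
  -- 1`.
  have h2 : u = ((2 * α * β * t)⁻¹ *
      ((1 - α) + α * (2 * β * (2 * β * t) - 2 * β + 1) - l)) • V.starProjection u := by
    have h3 : (2 * α * β * t) • u =
        ((1 - α) + α * (2 * β * (2 * β * t) - 2 * β + 1) - l) • V.starProjection u := by
      rw [← sub_eq_zero] at h ⊢
      rw [← neg_eq_zero, ← h]
      module
    rw [mul_smul, ← h3, smul_smul, inv_mul_cancel₀ (by positivity), one_smul]
  have h4 : V.starProjection u = u := by
    rw [Submodule.starProjection_eq_self_iff, h2]
    exact V.smul_mem _ (V.starProjection_apply_mem u)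
  rw [h4, Submodule.starProjection_eq_self_iff.2 hu] at hC
  have : (1 - t) • u = 0 := by rw [sub_smul, ← hC]; simp
  rcases smul_eq_zero.1 this with h | h
  · exact h1 (by linarith)
  · exact hu0 h

end Geometry

/-! ### The Friedrichs angle as an extremal eigenvalue -/

section Friedrichs

variable {n : ℕ} (U V : Submodule ℝ (EuclideanSpace ℝ (Fin n)))

theorem friedrichsCos_bddAbove : BddAbove {t : ℝ | ∃ u ∈ U ⊓ (U ⊓ V)ᗮ, ∃ v ∈ V ⊓ (U ⊓ V)ᗮ,
    ‖u‖ ≤ 1 ∧ ‖v‖ ≤ 1 ∧ t = inner ℝ u v} := by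
  refine ⟨1, ?_⟩
  rintro t ⟨u, -, v, -, hu, hv, rfl⟩
  exact (real_inner_le_norm u v).trans (mul_le_one₀ hu (norm_nonneg v) hv)

theorem friedrichsCos_nonneg : 0 ≤ friedrichsCos U V :=
  le_csSup (friedrichsCos_bddAbove U V)
    ⟨0, Submodule.zero_mem _, 0, Submodule.zero_mem _, by simp, by simp, by simp⟩

theorem friedrichsCos_comm : friedrichsCos U V = friedrichsCos V U := by
  unfold friedrichsCos
  congr 1
  ext t
  rw [inf_comm V U]
  constructor
  · rintro ⟨u, hu, v, hv, h1, h2, rfl⟩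
    exact ⟨v, hv, u, hu, h2, h1, real_inner_comm _ _⟩
  · rintro ⟨u, hu, v, hv, h1, h2, rfl⟩
    exact ⟨v, hv, u, hu, h2, h1, real_inner_comm _ _⟩

variable {U V}

theorem inner_le_friedrichsCos {u v : EuclideanSpace ℝ (Fin n)} (hu : u ∈ U ⊓ (U ⊓ V)ᗮ)
    (hv : v ∈ V ⊓ (U ⊓ V)ᗮ) : inner ℝ u v ≤ friedrichsCos U V * (‖u‖ * ‖v‖) := by
  rcases eq_or_ne u 0 with rfl | hu0
  · simp
  rcases eq_or_ne v 0 with rfl | hv0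
  · simp
  have hu1 := norm_pos_iff.2 hu0
  have hv1 := norm_pos_iff.2 hv0
  have h : inner ℝ (‖u‖⁻¹ • u) (‖v‖⁻¹ • v) ≤ friedrichsCos U V :=
    le_csSup (friedrichsCos_bddAbove U V) ⟨_, Submodule.smul_mem _ _ hu, _,
      Submodule.smul_mem _ _ hv, by simp [norm_smul, hu1.ne'], by simp [norm_smul, hv1.ne'], rfl⟩
  rw [real_inner_smul_left, real_inner_smul_right, ← mul_assoc, ← mul_inv,
    inv_mul_le_iff₀ (by positivity)] at h
  linarith

theorem starProjection_mem_orthogonal_inf {u : EuclideanSpace ℝ (Fin n)} (hu : u ∈ (U ⊓ V)ᗮ) :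
    V.starProjection u ∈ V ⊓ (U ⊓ V)ᗮ := by
  refine ⟨V.starProjection_apply_mem u, (Submodule.mem_orthogonal _ _).2 fun w hw => ?_⟩
  rw [← Submodule.inner_starProjection_left_eq_right, Submodule.starProjection_eq_self_iff.2 hw.2]
  exact Submodule.inner_right_of_mem_orthogonal hw hu

/-- Identifies the Rayleigh quotient of `cosSq` on `U`, the link between its eigenvalues and the
supremum defining `c_F`. -/
theorem inner_cosSq_self {u : EuclideanSpace ℝ (Fin n)} (hu : u ∈ U) :
    inner ℝ (cosSq U V u) u = ‖V.starProjection u‖ ^ 2 := by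
  rw [cosSq_of_mem_left hu, Submodule.inner_starProjection_left_eq_right,
    Submodule.starProjection_eq_self_iff.2 hu, ← real_inner_self_eq_norm_sq,
    Submodule.inner_starProjection_left_eq_right V u (V.starProjection u), starProjection_idem,
    Submodule.inner_starProjection_left_eq_right]

theorem mem_orthogonal_inf_of_cosSq {t : ℝ} (ht : t ≠ 1) {x : EuclideanSpace ℝ (Fin n)}
    (hx : cosSq U V x = t • x) : x ∈ (U ⊓ V)ᗮ := by
  rw [Submodule.mem_orthogonal]
  intro w hw
  exact inner_eq_zero_of_cosSq ht hx (cosSq_of_mem_inf hw)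

/-- The pair `u`, `P_V u` is admissible for `c_F`, and `⟪u, P_V u⟫ = ‖P_V u‖² = t‖u‖²`; hence `‖P_V
u‖ ≤ c_F ‖u‖`. -/
theorem cosSq_eigenvalue_mem_Icc_of_mem {t : ℝ} (ht : t ≠ 1) {u : EuclideanSpace ℝ (Fin n)}
    (hu : u ∈ U) (hu0 : u ≠ 0) (hx : cosSq U V u = t • u) :
    0 ≤ t ∧ t ≤ friedrichsCos U V ^ 2 := by
  have h1 := inner_cosSq_self (V := V) hu
  rw [hx, real_inner_smul_left, real_inner_self_eq_norm_sq] at h1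
  have hpos : 0 < ‖u‖ := norm_pos_iff.2 hu0
  have ht0 : 0 ≤ t := by
    by_contra! h
    nlinarith [sq_nonneg ‖V.starProjection u‖, pow_pos hpos 2]
  have hmem := mem_orthogonal_inf_of_cosSq ht hx
  have h2 := inner_le_friedrichsCos ⟨hu, hmem⟩ (starProjection_mem_orthogonal_inf hmem)
  have h3 : inner ℝ u (V.starProjection u) = ‖V.starProjection u‖ ^ 2 := by
    rw [← real_inner_self_eq_norm_sq, Submodule.inner_starProjection_left_eq_right,
      starProjection_idem]
  rw [h3] at h2
  refine ⟨ht0, ?_⟩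
  have hc := friedrichsCos_nonneg U V
  have hv0 := norm_nonneg (V.starProjection u)
  have h4 : ‖V.starProjection u‖ ≤ friedrichsCos U V * ‖u‖ := by
    rcases hv0.eq_or_lt with h | h
    · rw [← h]; positivity
    · refine le_of_mul_le_mul_right ?_ h
      nlinarith
  have h5 : t * ‖u‖ ^ 2 ≤ friedrichsCos U V ^ 2 * ‖u‖ ^ 2 := by
    rw [h1, ← mul_pow]
    exact pow_le_pow_left₀ hv0 h4 2
  exact le_of_mul_le_mul_right h5 (by positivity)

/-- Every eigenvalue of `cosSq` other than `1` lies in `[0, c_F²]`. -/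
theorem cosSq_eigenvalue_mem_Icc {t : ℝ} (ht : t ≠ 1) {x : EuclideanSpace ℝ (Fin n)}
    (hx0 : x ≠ 0) (hx : cosSq U V x = t • x) : 0 ≤ t ∧ t ≤ friedrichsCos U V ^ 2 := by
  by_cases hU : U.starProjection x = 0
  · by_cases hV : V.starProjection x = 0
    · have h : t • x = x := by rw [← hx, cosSq_apply, hU, hV]; simp
      have : (t - 1) • x = 0 := by rw [sub_smul, h]; simp
      rcases smul_eq_zero.1 this with h | h
      · exact absurd (by linarith) ht
      · exact absurd h hx0
    · rw [friedrichsCos_comm]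
      refine cosSq_eigenvalue_mem_Icc_of_mem ht (V.starProjection_apply_mem x) hV ?_
      rw [cosSq_comm, cosSq_starProjection_right, hx, map_smul]
  · refine cosSq_eigenvalue_mem_Icc_of_mem ht (U.starProjection_apply_mem x) hU ?_
    rw [cosSq_starProjection_left, hx, map_smul]

/-- The Friedrichs cosine is attained along an eigenvector of `cosSq` lying in `U`. -/
theorem exists_eigenvector_friedrichsCos (hU : U ≠ U ⊓ V) :
    friedrichsCos U V < 1 ∧ ∃ u ∈ U, u ≠ 0 ∧ cosSq U V u = friedrichsCos U V ^ 2 • u := by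
  set W := U ⊓ (U ⊓ V)ᗮ with hW
  have hinv : ∀ x ∈ W, cosSq U V x ∈ W := by
    intro x hx
    refine ⟨?_, ?_⟩
    · rw [cosSq_of_mem_left hx.1]; exact U.starProjection_apply_mem _
    · refine (Submodule.mem_orthogonal _ _).2 fun w hw => ?_
      rw [← cosSq_isSymmetric U V w x, cosSq_of_mem_inf hw]
      exact Submodule.inner_right_of_mem_orthogonal hw hx.2
  have hne : W ≠ ⊥ := by
    intro h
    apply hU
    refine le_antisymm (fun x hx => ?_) inf_le_left
    have h1 : x - (U ⊓ V).starProjection x ∈ W :=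
      ⟨U.sub_mem hx ((U ⊓ V).starProjection_apply_mem x).1,
        Submodule.sub_starProjection_mem_orthogonal x⟩
    rw [h, Submodule.mem_bot, sub_eq_zero] at h1
    rw [h1]
    exact (U ⊓ V).starProjection_apply_mem x
  have : Nontrivial W := (Submodule.nontrivial_iff_ne_bot).2 hne
  have hsym := (cosSq_isSymmetric U V).restrict_invariant hinv
  -- In finite dimension the supremum `S` of the Rayleigh quotient is an eigenvalue; it turns out to
  -- be `c_F²`.
  have hev := hsym.hasEigenvalue_iSup_of_finiteDimensional
  set S := ⨆ x : { x : W // x ≠ 0 },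
    RCLike.re (inner ℝ (((cosSq U V).restrict hinv) x) (x : W)) / ‖(x : W)‖ ^ 2 with hS
  obtain ⟨⟨u, huW⟩, hu⟩ := hev.exists_hasEigenvector
  have hu0 : u ≠ 0 := fun h => hu.2 (Subtype.ext h)
  have hCu : cosSq U V u = S • u := congrArg Subtype.val hu.apply_eq_smul
  have hpos : 0 < ‖u‖ := norm_pos_iff.2 hu0
  have hSu := inner_cosSq_self (V := V) huW.1
  rw [hCu, real_inner_smul_left, real_inner_self_eq_norm_sq] at hSu
  -- `S ≥ 1` would give `‖P_V u‖ = ‖u‖`, placing `u` in `U ⊓ V` as well as in its orthogonal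
  -- complement.
  have hS1 : S < 1 := by
    by_contra! h
    have h1 := V.norm_starProjection_apply_le u
    have h2 : ‖V.starProjection u‖ = ‖u‖ := by
      refine le_antisymm h1 ?_
      refine le_of_sq_le_sq ?_ (norm_nonneg _)
      nlinarith [pow_pos hpos 2]
    have huV : u ∈ V := (Submodule.mem_iff_norm_starProjection V u).2 h2
    have huUV : u ∈ U ⊓ V := ⟨huW.1, huV⟩
    exact hu0 (inner_self_eq_zero.1 (Submodule.inner_right_of_mem_orthogonal huUV huW.2))
  have hle := cosSq_eigenvalue_mem_Icc hS1.ne hu0 hCu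
  have hbdd : ∀ x ∈ W, ‖V.starProjection x‖ ^ 2 ≤ S * ‖x‖ ^ 2 := by
    intro x hx
    rcases eq_or_ne x 0 with rfl | hx0
    · simp
    have hb : BddAbove (Set.range fun x : { x : W // x ≠ 0 } =>
        RCLike.re (inner ℝ (((cosSq U V).restrict hinv) x) (x : W)) / ‖(x : W)‖ ^ 2) := by
      refine ⟨1, ?_⟩
      rintro _ ⟨⟨⟨y, hy⟩, hy0⟩, rfl⟩
      have : inner ℝ (cosSq U V y) y / ‖y‖ ^ 2 ≤ 1 := by
        rw [inner_cosSq_self hy.1]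
        exact div_le_one_of_le₀ (pow_le_pow_left₀ (norm_nonneg _)
          (V.norm_starProjection_apply_le y) 2) (by positivity)
      exact this
    have h := le_ciSup hb ⟨⟨x, hx⟩, fun h => hx0 (congrArg Subtype.val h)⟩
    have h' : inner ℝ (cosSq U V x) x / ‖x‖ ^ 2 ≤ S := h
    have hxp : 0 < ‖x‖ := norm_pos_iff.2 hx0
    rwa [inner_cosSq_self hx.1, div_le_iff₀ (by positivity)] at h'
  -- Cauchy–Schwarz applied to `⟪x, y⟫ = ⟪P_V x, y⟫`, with `‖P_V x‖² ≤ S‖x‖²`.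
  have hge : friedrichsCos U V ≤ Real.sqrt S := by
    refine csSup_le ⟨0, 0, Submodule.zero_mem _, 0, Submodule.zero_mem _,
      by simp, by simp, by simp⟩ ?_
    rintro t ⟨x, hx, y, hy, hx1, hy1, rfl⟩
    have h1 : inner ℝ x y = inner ℝ (V.starProjection x) y := by
      rw [Submodule.inner_starProjection_left_eq_right,
        Submodule.starProjection_eq_self_iff.2 hy.1]
    rw [h1]
    refine (real_inner_le_norm _ _).trans ?_
    refine (mul_le_of_le_one_right (norm_nonneg _) hy1).trans ?_
    refine Real.le_sqrt_of_sq_le ((hbdd x hx).trans ?_)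
    exact mul_le_of_le_one_right hle.1 (pow_le_one₀ (norm_nonneg _) hx1)
  have hS2 : friedrichsCos U V ^ 2 = S := by
    refine le_antisymm ?_ hle.2
    calc friedrichsCos U V ^ 2 ≤ Real.sqrt S ^ 2 :=
          pow_le_pow_left₀ (friedrichsCos_nonneg U V) hge 2
      _ = S := Real.sq_sqrt hle.1
  refine ⟨?_, u, huW.1, hu0, by rw [hS2]; exact hCu⟩
  exact lt_of_pow_lt_pow_left₀ 2 zero_le_one (by rw [hS2]; simpa using hS1)

end Friedrichs

/-! ### Passage from real vectors to complex matrices -/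

section Complexification

variable {n : ℕ}

/-- A real vector regarded as a complex one. -/
def ofRealVec (x : EuclideanSpace ℝ (Fin n)) : Fin n → ℂ := fun i => (x i : ℂ)

theorem ofRealVec_sub (x y : EuclideanSpace ℝ (Fin n)) :
    ofRealVec (x - y) = ofRealVec x - ofRealVec y := by
  ext i; simp [ofRealVec]

theorem ofRealVec_smul (a : ℝ) (x : EuclideanSpace ℝ (Fin n)) :
    ofRealVec (a • x) = (a : ℂ) • ofRealVec x := by
  ext i; simp [ofRealVec]

theorem ofRealVec_sum {ι : Type*} (s : Finset ι) (f : ι → EuclideanSpace ℝ (Fin n)) :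
    ofRealVec (∑ i ∈ s, f i) = ∑ i ∈ s, ofRealVec (f i) := by
  ext j; simp [ofRealVec]

theorem ofRealVec_eq_zero {x : EuclideanSpace ℝ (Fin n)} : ofRealVec x = 0 ↔ x = 0 := by
  constructor
  · intro h
    ext i
    have := congrFun h i
    simpa [ofRealVec] using this
  · rintro rfl
    ext i; simp [ofRealVec]

theorem toComplex_mulVec (A : Matrix (Fin n) (Fin n) ℝ) (x : EuclideanSpace ℝ (Fin n)) :
    (toComplex A).mulVec (ofRealVec x) =
      ofRealVec (Matrix.toEuclideanCLM (n := Fin n) (𝕜 := ℝ) A x) := by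
  ext i
  exact (RingHom.map_mulVec Complex.ofRealHom A x.ofLp i).symm

theorem toEuclideanCLM_projMatrix (W : Submodule ℝ (EuclideanSpace ℝ (Fin n))) :
    Matrix.toEuclideanCLM (n := Fin n) (𝕜 := ℝ) (projMatrix W) = W.starProjection :=
  StarAlgEquiv.apply_symm_apply _ _

theorem toEuclideanCLM_operator (U V : Submodule ℝ (EuclideanSpace ℝ (Fin n))) (α β : ℝ)
    (x : EuclideanSpace ℝ (Fin n)) :
    Matrix.toEuclideanCLM (n := Fin n) (𝕜 := ℝ) (operator U V α β) x = aamrMap U V α β x := by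
  simp [operator, aamrMap, toEuclideanCLM_projMatrix]

theorem toComplex_operator_mulVec (U V : Submodule ℝ (EuclideanSpace ℝ (Fin n))) (α β : ℝ)
    (x : EuclideanSpace ℝ (Fin n)) :
    (toComplex (operator U V α β)).mulVec (ofRealVec x) = ofRealVec (aamrMap U V α β x) := by
  rw [toComplex_mulVec, toEuclideanCLM_operator]

theorem toComplex_projMatrix_mulVec (W : Submodule ℝ (EuclideanSpace ℝ (Fin n)))
    (x : EuclideanSpace ℝ (Fin n)) :
    (toComplex (projMatrix W)).mulVec (ofRealVec x) = ofRealVec (W.starProjection x) := by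
  rw [toComplex_mulVec, toEuclideanCLM_projMatrix]

theorem toComplex_operator_mul_projMatrix (U V : Submodule ℝ (EuclideanSpace ℝ (Fin n)))
    (α β : ℝ) :
    toComplex (operator U V α β) * toComplex (projMatrix (Uᗮ ⊓ Vᗮ)) =
      toComplex (projMatrix (Uᗮ ⊓ Vᗮ)) := by
  have h : operator U V α β * projMatrix (Uᗮ ⊓ Vᗮ) = projMatrix (Uᗮ ⊓ Vᗮ) := by
    apply (Matrix.toEuclideanCLM (n := Fin n) (𝕜 := ℝ)).injective
    refine ContinuousLinearMap.ext fun x => ?_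
    change Matrix.toEuclideanCLM (n := Fin n) (𝕜 := ℝ) _ x =
      Matrix.toEuclideanCLM (n := Fin n) (𝕜 := ℝ) _ x
    rw [map_mul, mul_apply_eq_comp, toEuclideanCLM_operator, toEuclideanCLM_projMatrix,
      aamrMap_of_mem_orthogonal_inf _ _ ((Uᗮ ⊓ Vᗮ).starProjection_apply_mem x)]
  conv_rhs => rw [← h]
  exact (Matrix.map_mul (f := Complex.ofRealHom)).symm

/-- The complexified eigenvectors of `cosSq` span `ℂⁿ`. -/
theorem eq_top_of_ofRealVec_eigenvector_mem (U V : Submodule ℝ (EuclideanSpace ℝ (Fin n)))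
    (S : Submodule ℂ (Fin n → ℂ))
    (h : ∀ (x : EuclideanSpace ℝ (Fin n)) (t : ℝ), x ≠ 0 → cosSq U V x = t • x →
      ofRealVec x ∈ S) : S = ⊤ := by
  have hn : Module.finrank ℝ (EuclideanSpace ℝ (Fin n)) = n := by simp
  set b := (cosSq_isSymmetric U V).eigenvectorBasis hn
  have hb : ∀ i, ofRealVec (b i) ∈ S := fun i =>
    h _ _ (b.orthonormal.ne_zero i) ((cosSq_isSymmetric U V).apply_eigenvectorBasis hn i)
  have hreal : ∀ x, ofRealVec x ∈ S := by
    intro x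
    rw [← b.sum_repr x, ofRealVec_sum]
    refine Submodule.sum_mem _ fun i _ => ?_
    rw [ofRealVec_smul]
    exact S.smul_mem _ (hb i)
  rw [Submodule.eq_top_iff']
  intro v
  -- The standard basis vectors are real, so it suffices that all real vectors belong to `S`.
  rw [pi_eq_sum_univ' v]
  refine Submodule.sum_mem _ fun i _ => S.smul_mem _ ?_
  have := hreal (EuclideanSpace.single i 1)
  convert this using 1
  ext j
  rcases eq_or_ne j i with rfl | hj
  · simp [ofRealVec]
  · simp [ofRealVec, hj]
end Complexification

/-! ### Decay of matrix powers and linear rates -/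

section Decay

variable {n : ℕ}

theorem pow_mulVec_of_eigenvector {A : Matrix (Fin n) (Fin n) ℂ} {v : Fin n → ℂ} {l : ℂ}
    (h : A.mulVec v = l • v) (k : ℕ) : (A ^ k).mulVec v = l ^ k • v := by
  induction k with
  | zero => simp
  | succ k ih => rw [pow_succ, ← Matrix.mulVec_mulVec, h, Matrix.mulVec_smul, ih, smul_smul,
      pow_succ']

theorem pow_mulVec_of_generalized {A : Matrix (Fin n) (Fin n) ℂ} {v w : Fin n → ℂ} {l : ℂ}
    (hv : A.mulVec v = l • v + w) (hw : A.mulVec w = l • w) (k : ℕ) :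
    (A ^ (k + 1)).mulVec v = l ^ (k + 1) • v + ((k + 1 : ℂ) * l ^ k) • w := by
  induction k with
  | zero => simp [hv]
  | succ k ih =>
    rw [pow_succ', ← Matrix.mulVec_mulVec, ih, Matrix.mulVec_add, Matrix.mulVec_smul,
      Matrix.mulVec_smul, hv, hw]
    push_cast
    module

/-- The vectors along which the powers of `A` decay at least as fast as `μ ^ k`. -/
def decaySubmodule (A : Matrix (Fin n) (Fin n) ℂ) (μ : ℝ) :
    Submodule ℂ (Fin n → ℂ) where
  carrier := {v | ∃ M : ℝ, ∀ k : ℕ, ‖(A ^ k).mulVec v‖ ≤ M * μ ^ k}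
  add_mem' := by
    rintro v w ⟨M, hM⟩ ⟨N, hN⟩
    refine ⟨M + N, fun k => ?_⟩
    rw [Matrix.mulVec_add, add_mul]
    exact (norm_add_le _ _).trans (add_le_add (hM k) (hN k))
  zero_mem' := ⟨0, fun k => by simp⟩
  smul_mem' := by
    rintro c v ⟨M, hM⟩
    refine ⟨‖c‖ * M, fun k => ?_⟩
    rw [Matrix.mulVec_smul, norm_smul, mul_assoc]
    exact mul_le_mul_of_nonneg_left (hM k) (norm_nonneg c)

theorem mem_decaySubmodule_of_eigenvector {A : Matrix (Fin n) (Fin n) ℂ} {μ : ℝ}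
    {v : Fin n → ℂ} {l : ℂ} (h : A.mulVec v = l • v) (hl : ‖l‖ ≤ μ) :
    v ∈ decaySubmodule A μ := by
  refine ⟨‖v‖, fun k => ?_⟩
  rw [pow_mulVec_of_eigenvector h, norm_smul, norm_pow, mul_comm]
  gcongr

/-- `(A - b)v` and `(A - a)v` are killed by `A - a` and `A - b`, and their difference is `(a - b)v`.
-/
theorem mem_decaySubmodule_of_distinct_roots {A : Matrix (Fin n) (Fin n) ℂ} {μ : ℝ}
    {v : Fin n → ℂ} {a b : ℂ} (hab : a ≠ b)
    (h : A.mulVec (A.mulVec v) = (a + b) • A.mulVec v - (a * b) • v) (ha : ‖a‖ ≤ μ)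
    (hb : ‖b‖ ≤ μ) : v ∈ decaySubmodule A μ := by
  have h1 : A.mulVec v - b • v ∈ decaySubmodule A μ := by
    refine mem_decaySubmodule_of_eigenvector (l := a) ?_ ha
    rw [Matrix.mulVec_sub, h, Matrix.mulVec_smul]
    module
  have h2 : A.mulVec v - a • v ∈ decaySubmodule A μ := by
    refine mem_decaySubmodule_of_eigenvector (l := b) ?_ hb
    rw [Matrix.mulVec_sub, h, Matrix.mulVec_smul]
    module
  have h3 : v = (a - b)⁻¹ • ((A.mulVec v - b • v) - (A.mulVec v - a • v)) := by
    rw [eq_inv_smul_iff₀ (sub_ne_zero.2 hab)]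
    module
  rw [h3]
  exact Submodule.smul_mem _ _ (Submodule.sub_mem _ h1 h2)

/-- The strict inequality absorbs the polynomial factor in `k a^(k-1)`, since `(k+1)(‖a‖/μ)^k` is
bounded. -/
theorem mem_decaySubmodule_of_double_root {A : Matrix (Fin n) (Fin n) ℂ} {μ : ℝ}
    {v : Fin n → ℂ} {a : ℂ}
    (h : A.mulVec (A.mulVec v) = (a + a) • A.mulVec v - (a * a) • v) (ha : ‖a‖ < μ) :
    v ∈ decaySubmodule A μ := by
  have hμ0 : 0 < μ := (norm_nonneg a).trans_lt ha
  have hr : |‖a‖ / μ| < 1 := by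
    rw [abs_of_nonneg (by positivity)]
    exact (div_lt_one hμ0).2 ha
  obtain ⟨N, hN⟩ : ∃ N : ℝ, ∀ k : ℕ, ((k : ℝ) + 1) * (‖a‖ / μ) ^ k ≤ N := by
    have h1 := tendsto_self_mul_const_pow_of_abs_lt_one hr
    have h2 := tendsto_pow_atTop_nhds_zero_of_abs_lt_one hr
    obtain ⟨N, hN⟩ := (h1.add h2).bddAbove_range
    refine ⟨N, fun k => ?_⟩
    have := hN ⟨k, rfl⟩
    simp only at this
    linarith
  set w := A.mulVec v - a • v with hw
  have hv : A.mulVec v = a • v + w := by rw [hw]; abel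
  have hwe : A.mulVec w = a • w := by
    rw [hw, Matrix.mulVec_sub, h, Matrix.mulVec_smul]
    module
  refine ⟨‖v‖ + N / μ * ‖w‖, fun k => ?_⟩
  have hN0 : 0 ≤ N := le_trans (by simp) (hN 0)
  cases k with
  | zero =>
    simp only [pow_zero, Matrix.one_mulVec, mul_one]
    have : 0 ≤ N / μ * ‖w‖ := by positivity
    linarith
  | succ k =>
    rw [pow_mulVec_of_generalized hv hwe]
    refine (norm_add_le _ _).trans ?_
    rw [norm_smul, norm_smul, norm_mul, norm_pow, norm_pow, add_mul]
    have h1 : ‖a‖ ^ (k + 1) * ‖v‖ ≤ ‖v‖ * μ ^ (k + 1) := by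
      rw [mul_comm]
      gcongr
    have h2 : ‖(k + 1 : ℂ)‖ = (k : ℝ) + 1 := by
      rw [← Nat.cast_succ, Complex.norm_natCast, Nat.cast_succ]
    have h3 : ((k : ℝ) + 1) * ‖a‖ ^ k ≤ N * μ ^ k := by
      have := hN k
      rwa [div_pow, ← mul_div_assoc, div_le_iff₀ (by positivity)] at this
    have h4 : N / μ * ‖w‖ * μ ^ (k + 1) = N * μ ^ k * ‖w‖ := by
      rw [pow_succ]
      field_simp
    rw [h2, h4]
    gcongr

open scoped Matrix.Norms.L2Operator in
-- `A^k B = B` gives `A^k - B = A^k (1 - B)`, so decay along the vectors `e_j - B e_j` bounds every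
-- column, and finitely many entries bound the norm.
theorem linearlyConvergesTo_of_decay {A B : Matrix (Fin n) (Fin n) ℂ} {μ : ℝ} (hμ : 0 ≤ μ)
    (hμ1 : μ < 1) (hAB : A * B = B)
    (h : ∀ v : Fin n → ℂ, v - B.mulVec v ∈ decaySubmodule A μ) :
    LinearlyConvergesTo A B μ := by
  have hpow : ∀ k, A ^ k * B = B := by
    intro k
    induction k with
    | zero => simp
    | succ k ih => rw [pow_succ, mul_assoc, hAB, ih]
  have hcol : ∀ j, ∃ M : ℝ, ∀ k : ℕ, ∀ i, ‖(A ^ k - B) i j‖ ≤ M * μ ^ k := by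
    intro j
    obtain ⟨M, hM⟩ := h (Pi.single j 1)
    refine ⟨M, fun k i => le_trans ?_ (hM k)⟩
    have h1 : (A ^ k).mulVec (Pi.single j 1 - B.mulVec (Pi.single j 1)) =
        (A ^ k - B).mulVec (Pi.single j 1) := by
      rw [Matrix.mulVec_sub, Matrix.mulVec_mulVec, hpow, Matrix.sub_mulVec]
    rw [h1]
    have h2 : (A ^ k - B) i j = (A ^ k - B).mulVec (Pi.single j 1) i := by simp
    rw [h2]
    exact norm_le_pi_norm _ i
  choose M hM using hcol
  have hM0 : ∀ i j : Fin n, 0 ≤ M j := fun i j => by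
    have := (norm_nonneg _).trans (hM j 0 i)
    simpa using this
  refine ⟨hμ, hμ1, 1, one_pos,
    (∑ i : Fin n, ∑ j : Fin n, ‖Matrix.single i j (1 : ℂ)‖ * M j) + 1, ?_, fun k _ => ?_⟩
  · have : 0 ≤ ∑ i : Fin n, ∑ j : Fin n, ‖Matrix.single i j (1 : ℂ)‖ * M j :=
      Finset.sum_nonneg fun i _ => Finset.sum_nonneg fun j _ =>
        mul_nonneg (norm_nonneg _) (hM0 i j)
    linarith
  · rw [Matrix.matrix_eq_sum_single (A ^ k - B)]
    have h1 : ‖∑ i, ∑ j, Matrix.single i j ((A ^ k - B) i j)‖ ≤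
        ∑ i : Fin n, ∑ j : Fin n, ‖Matrix.single i j (1 : ℂ)‖ * M j * μ ^ k := by
      refine (norm_sum_le _ _).trans (Finset.sum_le_sum fun i _ => ?_)
      refine (norm_sum_le _ _).trans (Finset.sum_le_sum fun j _ => ?_)
      have : Matrix.single i j ((A ^ k - B) i j) =
          (A ^ k - B) i j • Matrix.single i j (1 : ℂ) := by
        rw [Matrix.smul_single, smul_eq_mul, mul_one]
      rw [this, norm_smul, mul_comm, mul_assoc]
      exact mul_le_mul_of_nonneg_left (hM j k i) (norm_nonneg _)
    refine h1.trans ?_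
    simp only [add_mul, Finset.sum_mul]
    have : 0 ≤ 1 * μ ^ k := by positivity
    linarith

open scoped Matrix.Norms.L2Operator in
/-- If `A` has rate `ν` and the orbit of `v` tends to `0`, then the orbit is `O(ν ^ k)`. -/
theorem IsLinearRate.exists_bound {A : Matrix (Fin n) (Fin n) ℂ} {ν : ℝ} (hν : IsLinearRate A ν)
    {v : Fin n → ℂ} (hv : Filter.Tendsto (fun k => (A ^ k).mulVec v) Filter.atTop (nhds 0)) :
    ∃ k₀ : ℕ, ∃ M : ℝ, ∀ k ≥ k₀, ‖(A ^ k).mulVec v‖ ≤ M * ν ^ k := by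
  obtain ⟨B, hν0, hν1, k₀, -, M, hM, hb⟩ := hν
  have key : ∀ k ≥ k₀, ‖(A ^ k).mulVec v - B.mulVec v‖ ≤
      M * ‖WithLp.toLp 2 v‖ * ν ^ k := by
    intro k hk
    rw [← Matrix.sub_mulVec]
    calc ‖(A ^ k - B).mulVec v‖ ≤ ‖WithLp.toLp 2 ((A ^ k - B).mulVec v)‖ := by
          refine (pi_norm_le_iff_of_nonneg (norm_nonneg _)).2 fun i => ?_
          exact PiLp.norm_apply_le (WithLp.toLp 2 ((A ^ k - B).mulVec v)) i
      _ ≤ ‖A ^ k - B‖ * ‖WithLp.toLp 2 v‖ := Matrix.l2_opNorm_mulVec _ (WithLp.toLp 2 v)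
      _ ≤ M * ν ^ k * ‖WithLp.toLp 2 v‖ := by gcongr; exact hb k hk
      _ = _ := by ring
  -- The orbit of `v` tends both to `B v` and to `0`.
  have hB : B.mulVec v = 0 := by
    have h1 : Filter.Tendsto (fun k => (A ^ k).mulVec v - B.mulVec v) Filter.atTop (nhds 0) := by
      refine squeeze_zero_norm' (Filter.eventually_atTop.2 ⟨k₀, key⟩) ?_
      simpa using (tendsto_pow_atTop_nhds_zero_of_lt_one hν0 hν1).const_mul
        (M * ‖WithLp.toLp 2 v‖)
    have h2 := hv.sub h1
    simpa using tendsto_nhds_unique tendsto_const_nhds (h2.congr fun k => sub_sub_cancel _ _)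
  refine ⟨k₀, M * ‖WithLp.toLp 2 v‖, fun k hk => ?_⟩
  simpa [hB] using key k hk

/-- Otherwise `‖v‖ ≤ M(ν/‖l‖)^k` for all large `k`, and the right side tends to `0`. -/
theorem IsLinearRate.norm_eigenvalue_le {A : Matrix (Fin n) (Fin n) ℂ} {ν : ℝ}
    (hν : IsLinearRate A ν) {v : Fin n → ℂ} {l : ℂ} (hv0 : v ≠ 0) (hv : A.mulVec v = l • v)
    (hl : ‖l‖ < 1) : ‖l‖ ≤ ν := by
  have hν0 : 0 ≤ ν := hν.choose_spec.1
  have ht : Filter.Tendsto (fun k => (A ^ k).mulVec v) Filter.atTop (nhds 0) := by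
    simp only [pow_mulVec_of_eigenvector hv]
    simpa using (tendsto_pow_atTop_nhds_zero_of_norm_lt_one hl).smul_const v
  obtain ⟨k₀, M, hM⟩ := hν.exists_bound ht
  by_contra! hlt
  have hl0 : 0 < ‖l‖ := hν0.trans_lt hlt
  have h1 : ∀ k ≥ k₀, ‖v‖ ≤ M * (ν / ‖l‖) ^ k := by
    intro k hk
    have := hM k hk
    rw [pow_mulVec_of_eigenvector hv, norm_smul, norm_pow] at this
    rw [div_pow, ← mul_div_assoc, le_div_iff₀ (by positivity)]
    linarith
  have h2 : Filter.Tendsto (fun k : ℕ => M * (ν / ‖l‖) ^ k) Filter.atTop (nhds 0) := by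
    simpa using (tendsto_pow_atTop_nhds_zero_of_lt_one (by positivity)
      ((div_lt_one hl0).2 hlt)).const_mul M
  have h3 : ‖v‖ ≤ 0 := ge_of_tendsto h2 (Filter.eventually_atTop.2 ⟨k₀, h1⟩)
  exact hv0 (norm_le_zero_iff.1 h3)

/-- The modulus of a nonzero defective eigenvalue inside the unit disc is not a linear rate. -/
theorem not_isLinearRate_of_generalized {A : Matrix (Fin n) (Fin n) ℂ} {v w : Fin n → ℂ} {l : ℂ}
    (hv : A.mulVec v = l • v + w) (hw : A.mulVec w = l • w) (hw0 : w ≠ 0) (hl0 : l ≠ 0)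
    (hl1 : ‖l‖ < 1) : ¬ IsLinearRate A ‖l‖ := by
  intro hν
  have ht : Filter.Tendsto (fun k => (A ^ k).mulVec v) Filter.atTop (nhds 0) := by
    rw [← Filter.tendsto_add_atTop_iff_nat 1]
    simp only [pow_mulVec_of_generalized hv hw]
    have h1 := tendsto_pow_atTop_nhds_zero_of_norm_lt_one hl1
    have h2 : Filter.Tendsto (fun k : ℕ => (k : ℂ) * l ^ k) Filter.atTop (nhds 0) := by
      rw [tendsto_zero_iff_norm_tendsto_zero]
      simpa using tendsto_self_mul_const_pow_of_lt_one (norm_nonneg l) hl1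
    have h3 := ((Filter.tendsto_add_atTop_iff_nat 1).2 h1).smul_const v
    have h4 := ((h2.add h1).smul_const w)
    simpa [add_mul] using h3.add h4
  obtain ⟨k₀, M, hM⟩ := hν.exists_bound ht
  have hlp : 0 < ‖l‖ := norm_pos_iff.2 hl0
  have hwp : 0 < ‖w‖ := norm_pos_iff.2 hw0
  -- Beyond this `k` the term `(k+1) l^k w` outgrows what the rate `‖l‖` allows once `l^(k+1) v` is
  -- subtracted.
  obtain ⟨k, hk⟩ := exists_nat_gt (max (k₀ : ℝ) (((M + ‖v‖) * ‖l‖) / ‖w‖))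
  have hk1 : k₀ ≤ k + 1 := by
    have : (k₀ : ℝ) < k := (le_max_left _ _).trans_lt hk
    have : k₀ < k := by exact_mod_cast this
    omega
  have hk2 : (M + ‖v‖) * ‖l‖ < k * ‖w‖ := by
    have := (le_max_right _ _).trans_lt hk
    rwa [div_lt_iff₀ hwp] at this
  have h1 := hM (k + 1) hk1
  rw [pow_mulVec_of_generalized hv hw] at h1
  have h2 : ‖((k + 1 : ℂ) * l ^ k) • w‖ ≤ M * ‖l‖ ^ (k + 1) + ‖l‖ ^ (k + 1) * ‖v‖ := by
    have h3 : ((k + 1 : ℂ) * l ^ k) • w =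
        (l ^ (k + 1) • v + ((k + 1 : ℂ) * l ^ k) • w) - l ^ (k + 1) • v := by abel
    rw [h3]
    refine (norm_sub_le _ _).trans (add_le_add h1 ?_)
    rw [norm_smul, norm_pow]
  have h4 : ‖(k + 1 : ℂ)‖ = (k : ℝ) + 1 := by
    rw [← Nat.cast_succ, Complex.norm_natCast, Nat.cast_succ]
  rw [norm_smul, norm_mul, norm_pow, h4, pow_succ] at h2
  have hp : 0 < ‖l‖ ^ k := by positivity
  have h5 : ‖l‖ ^ k * (((k : ℝ) + 1) * ‖w‖) ≤ ‖l‖ ^ k * ((M + ‖v‖) * ‖l‖) := by linarith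
  have h6 := le_of_mul_le_mul_left h5 hp
  linarith

end Decay

/-! ### Eigenvalues and quadratic relations -/

section Spectrum

variable {n : ℕ}

theorem mem_spectrum_iff_exists_eigenvector {A : Matrix (Fin n) (Fin n) ℂ} {l : ℂ} :
    l ∈ spectrum ℂ A ↔ ∃ v, v ≠ 0 ∧ A.mulVec v = l • v := by
  rw [spectrum.mem_iff, Matrix.isUnit_iff_isUnit_det, isUnit_iff_ne_zero, not_not,
    ← Matrix.exists_mulVec_eq_zero_iff]
  refine exists_congr fun v => and_congr_right fun _ => ?_
  rw [Matrix.sub_mulVec, sub_eq_zero, Algebra.algebraMap_eq_smul_one, Matrix.smul_mulVec,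
    Matrix.one_mulVec, eq_comm]

/-- A quadratic equation satisfied by `A` at `v` puts `v` into the range of `l - A`, unless `l`
is a root. -/
theorem mem_range_of_not_root {A : Matrix (Fin n) (Fin n) ℂ} {v : Fin n → ℂ} {l s p : ℂ}
    (h : A.mulVec (A.mulVec v) = s • A.mulVec v - p • v) (hl : l ^ 2 - s * l + p ≠ 0) :
    v ∈ LinearMap.range (algebraMap ℂ (Matrix (Fin n) (Fin n) ℂ) l - A).mulVecLin := by
  -- With `q(X) = X² - sX + p`, `q(l) - q(A) = (l - A)(l - s + A)`, and `q(A)v = 0`.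
  refine ⟨(l ^ 2 - s * l + p)⁻¹ • ((l - s) • v + A.mulVec v), ?_⟩
  rw [Matrix.mulVecLin_apply, Matrix.mulVec_smul, inv_smul_eq_iff₀ hl, Matrix.sub_mulVec,
    Algebra.algebraMap_eq_smul_one, Matrix.smul_mulVec, Matrix.one_mulVec, Matrix.mulVec_add,
    Matrix.mulVec_smul, h]
  module

end Spectrum

/-! ### Scalar analysis of the roots and thresholds -/

section Radius

/-- Half the trace of the AAMR operator on a principal plane with squared cosine `t`. -/
noncomputable def halfTrace (α β t : ℝ) : ℝ := 1 - 2 * α * β + 2 * α * β ^ 2 * t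

/-- The determinant of the AAMR operator on a principal plane with squared cosine `t`. -/
noncomputable def blockDet (α β t : ℝ) : ℝ :=
  4 * (1 - α) * α * β ^ 2 * t + (1 - 2 * α * β) ^ 2

/-- The sign of `discr β t` decides whether the eigenvalues on a principal plane with squared
cosine `t` are real. -/
noncomputable def discr (β t : ℝ) : ℝ := β ^ 2 * t - 2 * β + 1

/-- The spectral radius of the AAMR operator on a principal plane with cosine `c`. -/
noncomputable def blockRadius (α β c : ℝ) : ℝ :=
  if discr β (c ^ 2) < 0 then Real.sqrt (blockDet α β (c ^ 2))
  else halfTrace α β (c ^ 2) + 2 * α * β * (c * Real.sqrt (discr β (c ^ 2)))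

theorem halfTrace_sq_sub_blockDet (α β t : ℝ) :
    halfTrace α β t ^ 2 - blockDet α β t = 4 * α ^ 2 * β ^ 2 * t * discr β t := by
  unfold halfTrace blockDet discr; ring

variable {α β : ℝ}

theorem blockDet_nonneg (hα : α ∈ Set.Ioc (0 : ℝ) 1) {t : ℝ} (ht : 0 ≤ t) :
    0 ≤ blockDet α β t := by
  have h1 : 0 ≤ (1 - α) * α * β ^ 2 * t :=
    mul_nonneg (mul_nonneg (mul_nonneg (by linarith [hα.2]) hα.1.le) (sq_nonneg β)) ht
  unfold blockDet
  nlinarith [sq_nonneg (1 - 2 * α * β)]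

theorem blockDet_mono (hα : α ∈ Set.Ioc (0 : ℝ) 1) {s t : ℝ} (hst : s ≤ t) :
    blockDet α β s ≤ blockDet α β t := by
  have h1 : 0 ≤ (1 - α) * α * β ^ 2 :=
    mul_nonneg (mul_nonneg (by linarith [hα.2]) hα.1.le) (sq_nonneg β)
  unfold blockDet
  nlinarith

theorem halfTrace_mono (hα : α ∈ Set.Ioc (0 : ℝ) 1) {s t : ℝ} (hst : s ≤ t) :
    halfTrace α β s ≤ halfTrace α β t := by
  have h1 : 0 ≤ α * β ^ 2 := mul_nonneg hα.1.le (sq_nonneg β)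
  unfold halfTrace
  nlinarith

theorem halfTrace_nonneg (hα : α ∈ Set.Ioc (0 : ℝ) 1) (hβ : β ∈ Set.Ioo (0 : ℝ) 1) {t : ℝ}
    (ht : 0 ≤ t) (hd : 0 ≤ discr β t) : 0 ≤ halfTrace α β t := by
  unfold discr at hd
  unfold halfTrace
  obtain ⟨hα0, hα1⟩ := hα
  obtain ⟨hβ0, hβ1⟩ := hβ
  rcases le_total β (1 / 2) with h | h
  · have h1 : 0 ≤ α * β ^ 2 * t := by positivity
    nlinarith [mul_nonneg hα0.le hβ0.le]
  · have h1 : α * (2 * β - 1) ≤ α * (β ^ 2 * t) := mul_le_mul_of_nonneg_left (by linarith) hα0.le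
    nlinarith [mul_nonneg hα0.le (by linarith : (0 : ℝ) ≤ 2 * β - 1)]

/-- Here `2β - 1 = β²t > 0`, and the value is `1 - 2α(1-β)`. Positivity makes the double root
nonzero, so that a Jordan block there really spoils the rate. -/
theorem halfTrace_pos_of_discr_eq_zero (hα : α ∈ Set.Ioc (0 : ℝ) 1) (hβ : β ∈ Set.Ioo (0 : ℝ) 1)
    {t : ℝ} (ht : 0 < t) (hd : discr β t = 0) : 0 < halfTrace α β t := by
  unfold discr at hd
  unfold halfTrace
  obtain ⟨hα0, hα1⟩ := hα
  obtain ⟨hβ0, hβ1⟩ := hβ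
  have h1 : 0 < β ^ 2 * t := by positivity
  have h2 : α * (β ^ 2 * t) = α * (2 * β - 1) := by rw [← sub_eq_zero]; linear_combination α * hd
  nlinarith

theorem halfTrace_le_blockRadius (hα : α ∈ Set.Ioc (0 : ℝ) 1) (hβ : β ∈ Set.Ioo (0 : ℝ) 1)
    {c : ℝ} (hc : 0 ≤ c) (hd : 0 ≤ discr β (c ^ 2)) :
    halfTrace α β (c ^ 2) ≤ blockRadius α β c := by
  rw [blockRadius, if_neg hd.not_gt]
  have : 0 ≤ 2 * α * β * (c * Real.sqrt (discr β (c ^ 2))) := by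
    have := hα.1; have := hβ.1; positivity
  linarith

theorem blockDet_le_blockRadius_sq (hα : α ∈ Set.Ioc (0 : ℝ) 1) (hβ : β ∈ Set.Ioo (0 : ℝ) 1)
    {c : ℝ} (hc : 0 ≤ c) : blockDet α β (c ^ 2) ≤ blockRadius α β c ^ 2 := by
  by_cases hd : discr β (c ^ 2) < 0
  · rw [blockRadius, if_pos hd, Real.sq_sqrt (blockDet_nonneg hα (sq_nonneg c))]
  · push Not at hd
    have h1 := halfTrace_le_blockRadius hα hβ hc hd
    have h2 := halfTrace_nonneg hα hβ (sq_nonneg c) hd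
    have h3 := halfTrace_sq_sub_blockDet α β (c ^ 2)
    have h4 : 0 ≤ 4 * α ^ 2 * β ^ 2 * c ^ 2 * discr β (c ^ 2) := by positivity
    nlinarith

theorem blockRadius_nonneg (hα : α ∈ Set.Ioc (0 : ℝ) 1) (hβ : β ∈ Set.Ioo (0 : ℝ) 1)
    {c : ℝ} (hc : 0 ≤ c) : 0 ≤ blockRadius α β c := by
  by_cases hd : discr β (c ^ 2) < 0
  · rw [blockRadius, if_pos hd]; exact Real.sqrt_nonneg _
  · push Not at hd
    exact (halfTrace_nonneg hα hβ (sq_nonneg c) hd).trans (halfTrace_le_blockRadius hα hβ hc hd)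

theorem blockRadius_lt_one (hα : α ∈ Set.Ioc (0 : ℝ) 1) (hβ : β ∈ Set.Ioo (0 : ℝ) 1)
    {c : ℝ} (hc : 0 ≤ c) (hc1 : c < 1) : blockRadius α β c < 1 := by
  obtain ⟨hα0, hα1⟩ := hα
  obtain ⟨hβ0, hβ1⟩ := hβ
  have hcc : c ^ 2 < 1 := by nlinarith
  have hab : 0 < α * β := mul_pos hα0 hβ0
  by_cases hd : discr β (c ^ 2) < 0
  · rw [blockRadius, if_pos hd, Real.sqrt_lt' one_pos]
    unfold blockDet
    have h1 : β * (1 - α) * c ^ 2 ≤ β * (1 - α) :=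
      mul_le_of_le_one_right (mul_nonneg hβ0.le (by linarith)) hcc.le
    have h2 : α * β * (β * (1 - α) * c ^ 2 + α * β - 1) < 0 :=
      mul_neg_of_pos_of_neg hab (by linarith)
    nlinarith
  · rw [blockRadius, if_neg hd]
    -- The squares of the two sides differ by exactly `1 - c²`.
    have h1 : c * Real.sqrt (discr β (c ^ 2)) < 1 - β * c ^ 2 := by
      have h2 : 0 < 1 - β * c ^ 2 := by nlinarith
      rw [← Real.sqrt_sq hc, ← Real.sqrt_mul (sq_nonneg c), Real.sqrt_sq hc, Real.sqrt_lt' h2]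
      unfold discr
      nlinarith
    have h3 := mul_lt_mul_of_pos_left h1 hab
    unfold halfTrace
    nlinarith

theorem inf_eigenvalue_le_blockRadius (hα : α ∈ Set.Ioc (0 : ℝ) 1) (hβ : β ∈ Set.Ioo (0 : ℝ) 1)
    {c : ℝ} (hc : 0 ≤ c) (hd : 0 ≤ discr β (c ^ 2)) :
    1 - 4 * α * β * (1 - β) ≤ blockRadius α β c := by
  refine le_trans ?_ (halfTrace_le_blockRadius hα hβ hc hd)
  obtain ⟨hα0, hα1⟩ := hα
  obtain ⟨hβ0, hβ1⟩ := hβ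
  unfold discr at hd
  unfold halfTrace
  have hab : 0 < α * β := mul_pos hα0 hβ0
  have h1 : 2 * β - 1 ≤ β * c ^ 2 := by
    rcases le_total β (1 / 2) with h | h
    · have : 0 ≤ β * c ^ 2 := by positivity
      linarith
    · nlinarith
  nlinarith [mul_le_mul_of_nonneg_left h1 hab.le]

theorem inf_eigenvalue_nonneg (hα : α ∈ Set.Ioc (0 : ℝ) 1) (hβ : β ∈ Set.Ioo (0 : ℝ) 1) :
    0 ≤ 1 - 4 * α * β * (1 - β) := by
  obtain ⟨hα0, hα1⟩ := hα
  obtain ⟨hβ0, hβ1⟩ := hβ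
  have h1 : 0 ≤ β * (1 - β) := mul_nonneg hβ0.le (by linarith)
  nlinarith [sq_nonneg (2 * β - 1), mul_le_mul_of_nonneg_right hα1 h1]

theorem inf_eigenvalue_lt_one (hα : α ∈ Set.Ioc (0 : ℝ) 1) (hβ : β ∈ Set.Ioo (0 : ℝ) 1) :
    1 - 4 * α * β * (1 - β) < 1 := by
  have := mul_pos (mul_pos hα.1 hβ.1) (sub_pos.2 hβ.2)
  linarith

/-- A nonpositive square forces `z - m` to be purely imaginary. -/
theorem norm_sq_of_sub_sq_eq_nonpos {z : ℂ} {m r : ℝ} (hr : r ≤ 0) (h : (z - m) ^ 2 = r) :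
    ‖z‖ ^ 2 = m ^ 2 - r := by
  have h1 := congrArg Complex.re h
  have h2 := congrArg Complex.im h
  simp [sq] at h1 h2
  have h3 : z.re = m := by
    have h4 : (z.re - m) * z.im = 0 := by linarith
    rcases mul_eq_zero.1 h4 with h5 | h5
    · linarith
    · rw [h5] at h1
      nlinarith [sq_nonneg (z.re - m)]
  rw [Complex.sq_norm, Complex.normSq_apply, h3]
  rw [h3] at h1
  nlinarith

theorem norm_le_of_sub_sq_eq_nonneg {z : ℂ} {m r : ℝ} (hm : 0 ≤ m) (hr : 0 ≤ r)
    (h : (z - m) ^ 2 = r) : ‖z‖ ≤ m + Real.sqrt r := by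
  have h1 : ‖z - m‖ = Real.sqrt r := by
    rw [eq_comm, Real.sqrt_eq_iff_eq_sq hr (norm_nonneg _), ← norm_pow, h, Complex.norm_real,
      Real.norm_of_nonneg hr]
  calc ‖z‖ = ‖(m : ℂ) + (z - m)‖ := by rw [add_sub_cancel]
    _ ≤ ‖(m : ℂ)‖ + ‖z - m‖ := norm_add_le _ _
    _ = m + Real.sqrt r := by rw [h1, Complex.norm_real, Real.norm_of_nonneg hm]

/-- Nonreal roots have squared modulus `blockDet`, which is monotone in `t` and at `c²` never
exceeds the squared radius. Real roots at `t` force real roots at `c²`, and then both the half trace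
and the square-root term are monotone. -/
theorem norm_root_le_blockRadius (hα : α ∈ Set.Ioc (0 : ℝ) 1) (hβ : β ∈ Set.Ioo (0 : ℝ) 1)
    {c t : ℝ} (hc : 0 ≤ c) (ht : 0 ≤ t) (htc : t ≤ c ^ 2) {z : ℂ}
    (hz : z ^ 2 - (2 * halfTrace α β t : ℝ) * z + (blockDet α β t : ℝ) = 0) :
    ‖z‖ ≤ blockRadius α β c := by
  have hz2 : (z - (halfTrace α β t : ℝ)) ^ 2 = ((4 * α ^ 2 * β ^ 2 * t * discr β t : ℝ) : ℂ) := by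
    rw [← halfTrace_sq_sub_blockDet]
    push_cast at hz ⊢
    linear_combination hz
  have hα0 := hα.1
  have hβ0 := hβ.1
  rcases lt_or_ge (discr β t) 0 with hd | hd
  · have h1 := norm_sq_of_sub_sq_eq_nonpos
      (mul_nonpos_of_nonneg_of_nonpos (by positivity) hd.le) hz2
    rw [← halfTrace_sq_sub_blockDet, sub_sub_cancel] at h1
    refine le_of_sq_le_sq ?_ (blockRadius_nonneg hα hβ hc)
    rw [h1]
    exact (blockDet_mono hα htc).trans (blockDet_le_blockRadius_sq hα hβ hc)
  · have hdc : discr β t ≤ discr β (c ^ 2) := by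
      unfold discr
      nlinarith [mul_le_mul_of_nonneg_left htc (sq_nonneg β)]
    have h1 := norm_le_of_sub_sq_eq_nonneg (halfTrace_nonneg hα hβ ht hd) (by positivity) hz2
    refine h1.trans ?_
    rw [blockRadius, if_neg (hd.trans hdc).not_gt]
    refine add_le_add (halfTrace_mono hα htc) ?_
    rw [Real.sqrt_le_left (by positivity)]
    have h2 : (2 * α * β * (c * Real.sqrt (discr β (c ^ 2)))) ^ 2 =
        4 * α ^ 2 * β ^ 2 * c ^ 2 * discr β (c ^ 2) := by
      have := Real.sq_sqrt (hd.trans hdc)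
      linear_combination (2 * α * β * c) ^ 2 * this
    rw [h2]
    gcongr

/-- The two eigenvalues on a principal plane with cosine `c`. -/
theorem exists_roots (hα : α ∈ Set.Ioc (0 : ℝ) 1) (hβ : β ∈ Set.Ioo (0 : ℝ) 1)
    {c : ℝ} (hc : 0 ≤ c) : ∃ a b : ℂ, a + b = (2 * halfTrace α β (c ^ 2) : ℝ) ∧
      a * b = (blockDet α β (c ^ 2) : ℝ) ∧ ‖a‖ = blockRadius α β c ∧
      (c ≠ 0 → discr β (c ^ 2) ≠ 0 → a ≠ b) := by
  -- The sign of the square root is fixed in the real case so that `a` is the larger root, whose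
  -- modulus is the radius.
  obtain ⟨s, hs⟩ : ∃ s : ℂ, s ^ 2 = (discr β (c ^ 2) : ℝ) ∧
      (0 ≤ discr β (c ^ 2) → s = (Real.sqrt (discr β (c ^ 2)) : ℝ)) := by
    rcases le_or_gt 0 (discr β (c ^ 2)) with h | h
    · exact ⟨_, by rw [← Complex.ofReal_pow, Real.sq_sqrt h], fun _ => rfl⟩
    · obtain ⟨s, hs⟩ := IsAlgClosed.exists_pow_nat_eq ((discr β (c ^ 2) : ℝ) : ℂ) two_pos
      exact ⟨s, hs, fun h' => absurd h h'.not_gt⟩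
  obtain ⟨hs1, hs2⟩ := hs
  have hα0 := hα.1
  have hβ0 := hβ.1
  have hf : (((halfTrace α β (c ^ 2)) ^ 2 - blockDet α β (c ^ 2) : ℝ) : ℂ) =
      ((4 * α ^ 2 * β ^ 2 * c ^ 2 * discr β (c ^ 2) : ℝ) : ℂ) := by
    rw [halfTrace_sq_sub_blockDet]
  push_cast at hf
  refine ⟨(halfTrace α β (c ^ 2) : ℝ) + 2 * α * β * (c * s),
    (halfTrace α β (c ^ 2) : ℝ) - 2 * α * β * (c * s), by push_cast; ring, ?_, ?_, ?_⟩
  · linear_combination hf - 4 * (α : ℂ) ^ 2 * β ^ 2 * c ^ 2 * hs1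
  · rcases le_or_gt 0 (discr β (c ^ 2)) with h | h
    · have h0 := blockRadius_nonneg hα hβ hc
      rw [hs2 h]
      rw [blockRadius, if_neg h.not_gt] at h0 ⊢
      rw [← Real.norm_of_nonneg h0, ← Complex.norm_real]
      push_cast
      rfl
    · have h1 : ‖(halfTrace α β (c ^ 2) : ℝ) + 2 * α * β * (c * s)‖ ^ 2 =
          (halfTrace α β (c ^ 2)) ^ 2 - 4 * α ^ 2 * β ^ 2 * c ^ 2 * discr β (c ^ 2) := by
        apply norm_sq_of_sub_sq_eq_nonpos
          (mul_nonpos_of_nonneg_of_nonpos (by positivity) h.le)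
        push_cast
        linear_combination 4 * (α : ℂ) ^ 2 * β ^ 2 * c ^ 2 * hs1
      rw [← halfTrace_sq_sub_blockDet, sub_sub_cancel] at h1
      rw [blockRadius, if_pos h, ← h1, Real.sqrt_sq (norm_nonneg _)]
  · intro hc0 hd hab
    have hs0 : s ≠ 0 := by
      rintro rfl
      apply hd
      have : ((discr β (c ^ 2) : ℝ) : ℂ) = 0 := by rw [← hs1]; simp
      exact_mod_cast this
    have h1 : (4 * α * β * c : ℂ) * s = 0 := by linear_combination hab
    have h2 : (4 * α * β * c : ℂ) ≠ 0 := by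
      norm_cast
      positivity
    exact (mul_ne_zero h2 hs0) h1

theorem halfTrace_lt_blockRadius (hα : α ∈ Set.Ioc (0 : ℝ) 1) (hβ : β ∈ Set.Ioo (0 : ℝ) 1)
    {c t : ℝ} (hc : 0 ≤ c) (htc : t < c ^ 2) (hd : discr β t = 0) :
    halfTrace α β t < blockRadius α β c := by
  have hα0 := hα.1
  have hβ0 := hβ.1
  have hdc : 0 < discr β (c ^ 2) := by
    rw [← hd]
    unfold discr
    nlinarith [mul_lt_mul_of_pos_left htc (pow_pos hβ0 2)]
  refine lt_of_lt_of_le ?_ (halfTrace_le_blockRadius hα hβ hc hdc.le)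
  unfold halfTrace
  have : 0 < α * β ^ 2 := by positivity
  nlinarith

theorem lt_cHat_iff (hβ : β ∈ Set.Ioo (0 : ℝ) 1) {c : ℝ} (hc : 0 ≤ c) :
    c < cHat β ↔ discr β (c ^ 2) < 0 := by
  have hβ0 := hβ.1
  rw [cHat, lt_div_iff₀ hβ0, Real.lt_sqrt (by positivity), lt_max_iff, discr]
  constructor
  · rintro (h | h)
    · exact absurd h (by positivity : (0 : ℝ) ≤ (c * β) ^ 2).not_gt
    · nlinarith
  · intro h
    right
    nlinarith

/-- The first conclusion places `c(α,β)` below `ĉ_β`, so the first regime lies inside the range of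
nonreal roots. -/
theorem lt_cThreshold (hα : α ∈ Set.Ioc (0 : ℝ) 1) (hβ : β ∈ Set.Ioo (0 : ℝ) 1) {c : ℝ}
    (hc : 0 ≤ c) (h : c < cThreshold α β) :
    discr β (c ^ 2) < 0 ∧ blockDet α β (c ^ 2) ≤ (1 - 4 * α * β * (1 - β)) ^ 2 := by
  obtain ⟨hα0, hα1⟩ := hα
  obtain ⟨hβ0, hβ1⟩ := hβ
  unfold cThreshold at h
  split_ifs at h with hα2
  swap
  · exact absurd h hc.not_gt
  have hY : 0 < 4 * (1 - α) * α * β ^ 2 := by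
    have := sub_pos.2 hα2; positivity
  rw [Real.lt_sqrt hc, lt_div_iff₀ hY, lt_max_iff] at h
  have h1 : c ^ 2 * (4 * (1 - α) * α * β ^ 2) <
      (1 - 4 * α * β * (1 - β)) ^ 2 - (1 - 2 * α * β) ^ 2 := by
    rcases h with h | h
    · exact absurd h (by positivity : (0 : ℝ) ≤ c ^ 2 * (4 * (1 - α) * α * β ^ 2)).not_gt
    · exact h
  refine ⟨?_, by unfold blockDet; linarith⟩
  -- The difference of squares in the threshold factors as `4αβ(2β-1)g`.
  set g := 1 - 3 * α * β + 2 * α * β ^ 2 with hg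
  have h2 : c ^ 2 * ((1 - α) * β) < (2 * β - 1) * g := by
    have h3 : (4 * α * β) * (c ^ 2 * ((1 - α) * β)) < (4 * α * β) * ((2 * β - 1) * g) := by
      rw [hg]; linarith
    exact lt_of_mul_lt_mul_left h3 (by positivity)
  have h4 : 0 ≤ c ^ 2 * ((1 - α) * β) := by
    have := sub_pos.2 hα2; positivity
  have hβ2 : 1 / 2 < β := by
    by_contra! h5
    have h6 : 0 ≤ g := by
      have h7 : β * (3 - 2 * β) ≤ 1 := by nlinarith
      have h8 : 0 ≤ β * (3 - 2 * β) := mul_nonneg hβ0.le (by linarith)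
      rw [hg]
      nlinarith
    nlinarith
  -- `1 - α - βg = (1-β)(1 - α(1-β)(1+2β))`.
  have h9 : β * g ≤ 1 - α := by
    have h10 : α * ((1 - β) * (1 + 2 * β)) ≤ 1 := by
      have : (1 - β) * (1 + 2 * β) ≤ 1 := by nlinarith
      have : 0 ≤ (1 - β) * (1 + 2 * β) := mul_nonneg (by linarith) (by linarith)
      nlinarith
    have h11 := mul_nonneg (sub_nonneg.2 hβ1.le) (sub_nonneg.2 h10)
    rw [hg]
    linarith
  have h12 : (1 - α) * (β ^ 2 * c ^ 2) < (1 - α) * (2 * β - 1) := by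
    have h13 := mul_lt_mul_of_pos_left h2 hβ0
    have h14 := mul_le_mul_of_nonneg_left h9 (by linarith : 0 ≤ 2 * β - 1)
    linarith
  have := lt_of_mul_lt_mul_left h12 (by linarith)
  unfold discr
  linarith

theorem le_of_cThreshold_le (hα : α ∈ Set.Ioc (0 : ℝ) 1) (hβ : β ∈ Set.Ioo (0 : ℝ) 1) {c : ℝ}
    (hc : 0 ≤ c) (h : cThreshold α β ≤ c) :
    (1 - 4 * α * β * (1 - β)) ^ 2 ≤ blockDet α β (c ^ 2) := by
  obtain ⟨hα0, hα1⟩ := hα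
  obtain ⟨hβ0, hβ1⟩ := hβ
  unfold cThreshold at h
  split_ifs at h with hα2
  · have hY : 0 < 4 * (1 - α) * α * β ^ 2 := by
      have := sub_pos.2 hα2; positivity
    rw [Real.sqrt_le_left hc, div_le_iff₀ hY] at h
    have := (le_max_right _ _).trans h
    unfold blockDet
    linarith
  -- Both `1 - 4β(1-β)` and the determinant equal `(1-2β)²`, which is at most `1`.
  · obtain rfl : α = 1 := le_antisymm hα1 (not_lt.1 hα2)
    unfold blockDet
    have h1 : 1 - 4 * 1 * β * (1 - β) = (1 - 2 * β) ^ 2 := by ring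
    have h2 : (1 - 2 * β) ^ 2 ≤ 1 := by nlinarith
    rw [h1]
    nlinarith [sq_nonneg (1 - 2 * β)]

/-- With `t = cos² θ`, `discr β t = (1-β)² - (β sin θ)²`. -/
theorem eq_one_div_one_add_sin_iff (hβ : β ∈ Set.Ioo (0 : ℝ) 1) {θ : ℝ} (hs : 0 ≤ Real.sin θ) :
    β = 1 / (1 + Real.sin θ) ↔ discr β (Real.cos θ ^ 2) = 0 := by
  rw [eq_div_iff (by positivity), discr, Real.cos_sq']
  have hβ0 := hβ.1
  have hβ1 := hβ.2
  constructor
  · intro h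
    have h1 : β * Real.sin θ = 1 - β := by linarith
    linear_combination (-(β * Real.sin θ) - (1 - β)) * h1
  · intro h
    have h1 : (β * Real.sin θ) ^ 2 = (1 - β) ^ 2 := by linear_combination -h
    rw [sq_eq_sq₀ (by positivity) (by linarith)] at h1
    linarith

end Radius

/-! ### Spectrum, convergence and optimality for the AAMR operator -/

section Main

variable {n : ℕ} {U V : Submodule ℝ (EuclideanSpace ℝ (Fin n))} {α β : ℝ}

theorem operator_mulVec_mulVec (α β : ℝ) {x : EuclideanSpace ℝ (Fin n)} {t : ℝ}
    (hx : cosSq U V x = t • x) :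
    (toComplex (operator U V α β)).mulVec ((toComplex (operator U V α β)).mulVec (ofRealVec x)) =
      ((2 * halfTrace α β t : ℝ) : ℂ) • (toComplex (operator U V α β)).mulVec (ofRealVec x)
        - ((blockDet α β t : ℝ) : ℂ) • ofRealVec x := by
  rw [toComplex_operator_mulVec, toComplex_operator_mulVec, aamrMap_aamrMap α β hx,
    ofRealVec_sub, ofRealVec_smul, ofRealVec_smul]
  rfl

/-- If `l` exceeds the bound it is a root of none of the block quadratics, so the range of `l - T`
contains all eigenvectors of `cosSq`, making `l - T` invertible. -/
theorem norm_le_of_mem_spectrum (hα : α ∈ Set.Ioc (0 : ℝ) 1) (hβ : β ∈ Set.Ioo (0 : ℝ) 1)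
    {l : ℂ} (hl : l ∈ spectrum ℂ (toComplex (operator U V α β))) (hl1 : l ≠ 1) :
    ‖l‖ ≤ max (1 - 4 * α * β * (1 - β)) (blockRadius α β (friedrichsCos U V)) := by
  by_contra! h
  obtain ⟨hκ, hr⟩ := max_lt_iff.1 h
  rw [spectrum.mem_iff] at hl
  apply hl
  rw [← Matrix.mulVec_surjective_iff_isUnit]
  suffices htop : LinearMap.range (algebraMap ℂ (Matrix (Fin n) (Fin n) ℂ) l -
      toComplex (operator U V α β)).mulVecLin = ⊤ from LinearMap.range_eq_top.1 htop
  refine eq_top_of_ofRealVec_eigenvector_mem U V _ ?_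
  intro x t hx0 hx
  refine mem_range_of_not_root (operator_mulVec_mulVec α β hx) ?_
  intro hroot
  by_cases ht : t = 1
  -- At `t = 1` the quadratic factors with roots `1` and `κ`.
  · have h1 : (l - 1) * (l - ((1 - 4 * α * β * (1 - β) : ℝ) : ℂ)) = 0 := by
      rw [← hroot, ht]
      unfold halfTrace blockDet
      push_cast
      ring
    rcases mul_eq_zero.1 h1 with h2 | h2
    · exact hl1 (sub_eq_zero.1 h2)
    · rw [sub_eq_zero.1 h2, Complex.norm_real,
        Real.norm_of_nonneg (inf_eigenvalue_nonneg hα hβ)] at hκ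
      exact lt_irrefl _ hκ
  · obtain ⟨ht0, htc⟩ := cosSq_eigenvalue_mem_Icc ht hx0 hx
    exact hr.not_ge
      (norm_root_le_blockRadius hα hβ (friedrichsCos_nonneg U V) ht0 htc hroot)

theorem inf_eigenvalue_mem_spectrum (hUV : U ⊓ V ≠ ⊥) (α β : ℝ) :
    ((1 - 4 * α * β * (1 - β) : ℝ) : ℂ) ∈ spectrum ℂ (toComplex (operator U V α β)) := by
  obtain ⟨w, hw, hw0⟩ := Submodule.exists_mem_ne_zero_of_ne_bot hUV
  refine mem_spectrum_iff_exists_eigenvector.2 ⟨ofRealVec w, mt ofRealVec_eq_zero.1 hw0, ?_⟩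
  rw [toComplex_operator_mulVec, aamrMap_of_mem_inf α β hw, ofRealVec_smul]

theorem eq_re_smul_of_ofRealVec_eq_smul {x y : EuclideanSpace ℝ (Fin n)} {l : ℂ}
    (h : ofRealVec x = l • ofRealVec y) : x = l.re • y := by
  ext i
  have := congrArg Complex.re (congrFun h i)
  simpa [ofRealVec] using this

/-- Some vector of a principal plane at the Friedrichs angle is not an eigenvector of the AAMR
operator. -/
theorem exists_not_eigenvector (hU : U ≠ U ⊓ V) (hα : α ≠ 0) (hβ : β ≠ 0)
    (hc : friedrichsCos U V ≠ 0) :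
    ∃ y : EuclideanSpace ℝ (Fin n), cosSq U V y = friedrichsCos U V ^ 2 • y ∧
      ∀ l : ℂ, (toComplex (operator U V α β)).mulVec (ofRealVec y) ≠ l • ofRealVec y := by
  obtain ⟨hc1, u, hu, hu0, hCu⟩ := exists_eigenvector_friedrichsCos hU
  refine ⟨V.starProjection u, by rw [cosSq_starProjection_right, hCu, map_smul], fun l hl => ?_⟩
  rw [toComplex_operator_mulVec] at hl
  have hc0 := friedrichsCos_nonneg U V
  exact aamrMap_starProjection_ne hα hβ (pow_ne_zero 2 hc) (by nlinarith) hu hu0 hCu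
    (eq_re_smul_of_ofRealVec_eq_smul hl)

theorem exists_mem_spectrum_norm_eq_blockRadius (hU : U ≠ U ⊓ V) (hα : α ∈ Set.Ioc (0 : ℝ) 1)
    (hβ : β ∈ Set.Ioo (0 : ℝ) 1) :
    ∃ l ∈ spectrum ℂ (toComplex (operator U V α β)),
      ‖l‖ = blockRadius α β (friedrichsCos U V) := by
  obtain ⟨a, b, hab, hmul, hnorm, -⟩ := exists_roots hα hβ (friedrichsCos_nonneg U V)
  refine ⟨a, mem_spectrum_iff_exists_eigenvector.2 ?_, hnorm⟩
  -- At `c_F = 0` the block is scalar, so `(T - b)y` would vanish; otherwise `(T - b)y ≠ 0` is an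
  -- eigenvector for `a`.
  by_cases hc : friedrichsCos U V = 0
  · obtain ⟨-, u, hu, hu0, hCu⟩ := exists_eigenvector_friedrichsCos hU
    rw [hc] at hab hmul hCu
    have ha : a = ((1 - 2 * α * β : ℝ) : ℂ) := by
      unfold halfTrace at hab
      unfold blockDet at hmul
      push_cast at hab hmul ⊢
      refine sub_eq_zero.1 (pow_eq_zero_iff two_ne_zero |>.1 ?_)
      linear_combination a * hab - hmul
    refine ⟨ofRealVec u, mt ofRealVec_eq_zero.1 hu0, ?_⟩
    rw [toComplex_operator_mulVec, aamrMap_of_cosSq_eq_zero α β (by simpa using hCu),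
      ofRealVec_smul, ha]
  · obtain ⟨y, hy, hne⟩ := exists_not_eigenvector hU hα.1.ne' hβ.1.ne' hc
    refine ⟨_, sub_ne_zero.2 (hne b), ?_⟩
    rw [Matrix.mulVec_sub, operator_mulVec_mulVec α β hy, Matrix.mulVec_smul, ← hab, ← hmul]
    module

theorem gamma_operator (hU : U ≠ U ⊓ V) (hUV : U ⊓ V ≠ ⊥) (hα : α ∈ Set.Ioc (0 : ℝ) 1)
    (hβ : β ∈ Set.Ioo (0 : ℝ) 1) :
    gamma (toComplex (operator U V α β)) =
      max (1 - 4 * α * β * (1 - β)) (blockRadius α β (friedrichsCos U V)) := by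
  refine (gamma_isGreatest _).unique ⟨?_, ?_⟩
  · rcases max_choice (1 - 4 * α * β * (1 - β)) (blockRadius α β (friedrichsCos U V)) with h | h
    · rw [h]
      refine ⟨((1 - 4 * α * β * (1 - β) : ℝ) : ℂ),
        Or.inr ⟨inf_eigenvalue_mem_spectrum hUV α β, ?_⟩, ?_⟩
      · rw [Set.mem_singleton_iff, Complex.ofReal_eq_one]
        exact (inf_eigenvalue_lt_one hα hβ).ne
      · exact (Complex.norm_real _).trans (Real.norm_of_nonneg (inf_eigenvalue_nonneg hα hβ))
    · rw [h]
      obtain ⟨l, hl, hnorm⟩ := exists_mem_spectrum_norm_eq_blockRadius hU hα hβ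
      refine ⟨l, Or.inr ⟨hl, ?_⟩, hnorm⟩
      rintro rfl
      have h1 := blockRadius_lt_one hα hβ (friedrichsCos_nonneg U V)
        (exists_eigenvector_friedrichsCos hU).1
      rw [← hnorm, norm_one] at h1
      exact lt_irrefl _ h1
  · rintro _ ⟨l, hl | hl, rfl⟩
    · rw [Set.mem_singleton_iff.1 hl]
      beta_reduce
      rw [norm_zero]
      exact le_max_of_le_left (inf_eigenvalue_nonneg hα hβ)
    · exact norm_le_of_mem_spectrum hα hβ hl.1 hl.2

/-- Allowing `μ = γ(T)` serves both the rates above `γ(T)` and optimality; `hdef` isolates the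
potentially defective blocks, where strict inequality is needed. -/
theorem linearlyConvergesTo_operator (hα : α ∈ Set.Ioc (0 : ℝ) 1) (hβ : β ∈ Set.Ioo (0 : ℝ) 1)
    {μ : ℝ} (hκ : 1 - 4 * α * β * (1 - β) ≤ μ)
    (hr : blockRadius α β (friedrichsCos U V) ≤ μ) (hμ1 : μ < 1)
    (hdef : ∀ t, 0 < t → t ≤ friedrichsCos U V ^ 2 → discr β t = 0 → halfTrace α β t < μ) :
    LinearlyConvergesTo (toComplex (operator U V α β))
      (toComplex (projMatrix (Uᗮ ⊓ Vᗮ))) μ := by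
  have hc := friedrichsCos_nonneg U V
  set T := toComplex (operator U V α β) with hT
  set B := toComplex (projMatrix (Uᗮ ⊓ Vᗮ)) with hB
  suffices htop : (decaySubmodule T μ).comap (LinearMap.id - B.mulVecLin) = ⊤ by
    refine linearlyConvergesTo_of_decay ((inf_eigenvalue_nonneg hα hβ).trans hκ) hμ1
      (toComplex_operator_mul_projMatrix U V α β) fun v => ?_
    have hv : v ∈ (decaySubmodule T μ).comap (LinearMap.id - B.mulVecLin) := by
      rw [htop]; trivial
    exact hv
  refine eq_top_of_ofRealVec_eigenvector_mem U V _ fun x t hx0 hx => ?_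
  rw [Submodule.mem_comap, LinearMap.sub_apply, LinearMap.id_apply, Matrix.mulVecLin_apply, hB,
    toComplex_projMatrix_mulVec, ← ofRealVec_sub]
  by_cases ht : t = 1
  · rw [ht, one_smul] at hx
    rw [starProjection_orthogonal_inf_of_cosSq_eq_self hx, sub_sub_cancel]
    refine mem_decaySubmodule_of_eigenvector (l := ((1 - 4 * α * β * (1 - β) : ℝ) : ℂ)) ?_ ?_
    · rw [hT, toComplex_operator_mulVec,
        aamrMap_of_mem_inf α β (exists_decomp_of_cosSq_eq_self hx).1, ofRealVec_smul]
    · rwa [Complex.norm_real, Real.norm_of_nonneg (inf_eigenvalue_nonneg hα hβ)]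
  rw [starProjection_orthogonal_inf_of_ne_one ht hx, sub_zero]
  obtain ⟨ht0, htc⟩ := cosSq_eigenvalue_mem_Icc ht hx0 hx
  have hroot : ∀ z : ℂ, z ^ 2 - (2 * halfTrace α β t : ℝ) * z + (blockDet α β t : ℝ) = 0 →
      ‖z‖ ≤ μ := fun z hz => (norm_root_le_blockRadius hα hβ hc ht0 htc hz).trans hr
  have hquad := operator_mulVec_mulVec α β hx
  rcases ht0.eq_or_lt with rfl | ht0
  · refine mem_decaySubmodule_of_eigenvector (l := ((1 - 2 * α * β : ℝ) : ℂ)) ?_ ?_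
    · rw [hT, toComplex_operator_mulVec, aamrMap_of_cosSq_eq_zero α β (by simpa using hx),
        ofRealVec_smul]
    · apply hroot
      unfold halfTrace blockDet
      push_cast
      ring
  by_cases hd : discr β t = 0
  · have hdet : blockDet α β t = halfTrace α β t * halfTrace α β t := by
      have := halfTrace_sq_sub_blockDet α β t
      rw [hd] at this
      linarith
    refine mem_decaySubmodule_of_double_root (a := (halfTrace α β t : ℝ)) ?_ ?_
    · rw [hT, hquad, hdet, two_mul]
      push_cast
      rfl
    · rw [Complex.norm_real,
        Real.norm_of_nonneg (halfTrace_nonneg hα hβ ht0.le hd.ge)]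
      exact hdef t ht0 htc hd
  · obtain ⟨a, b, hab, hmul, -, hne⟩ := exists_roots hα hβ (Real.sqrt_nonneg t)
    rw [Real.sq_sqrt ht0.le] at hab hmul hne
    refine mem_decaySubmodule_of_distinct_roots (hne (Real.sqrt_pos.2 ht0).ne' hd) ?_
      (hroot a ?_) (hroot b ?_)
    · rw [hT, hquad, hab, hmul]
    · rw [← hab, ← hmul]; ring
    · rw [← hab, ← hmul]; ring

theorem gamma_le_of_isLinearRate {A : Matrix (Fin n) (Fin n) ℂ} (hA : gamma A < 1) {ν : ℝ}
    (hν : IsLinearRate A ν) : gamma A ≤ ν := by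
  obtain ⟨l, hl | hl, hnorm⟩ := (gamma_isGreatest A).1
  · rw [← hnorm, Set.mem_singleton_iff.1 hl]
    simpa using hν.choose_spec.1
  · obtain ⟨v, hv0, hv⟩ := mem_spectrum_iff_exists_eigenvector.1 hl.1
    rw [← hnorm] at hA ⊢
    exact hν.norm_eigenvalue_le hv0 hv hA

/-- At a vanishing discriminant with positive Friedrichs cosine the dominant eigenvalue is
defective, hence its modulus is not a linear rate. -/
theorem not_isLinearRate_of_discr_eq_zero (hU : U ≠ U ⊓ V) (hα : α ∈ Set.Ioc (0 : ℝ) 1)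
    (hβ : β ∈ Set.Ioo (0 : ℝ) 1) (hc : friedrichsCos U V ≠ 0)
    (hd : discr β (friedrichsCos U V ^ 2) = 0) :
    ¬ IsLinearRate (toComplex (operator U V α β)) (blockRadius α β (friedrichsCos U V)) := by
  have hc0 := friedrichsCos_nonneg U V
  have hpos := halfTrace_pos_of_discr_eq_zero hα hβ (by positivity) hd
  have hr : blockRadius α β (friedrichsCos U V) = halfTrace α β (friedrichsCos U V ^ 2) := by
    rw [blockRadius, if_neg (by rw [hd]; exact lt_irrefl _), hd]
    simp
  have hnorm : ‖(halfTrace α β (friedrichsCos U V ^ 2) : ℂ)‖ =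
      blockRadius α β (friedrichsCos U V) := by
    rw [hr, Complex.norm_real, Real.norm_of_nonneg hpos.le]
  obtain ⟨y, hy, hne⟩ := exists_not_eigenvector hU hα.1.ne' hβ.1.ne' hc
  rw [← hnorm]
  refine not_isLinearRate_of_generalized (add_sub_cancel _ _).symm ?_ (sub_ne_zero.2 (hne _))
    (Complex.ofReal_ne_zero.2 hpos.ne') ?_
  · have hdet : blockDet α β (friedrichsCos U V ^ 2) =
        halfTrace α β (friedrichsCos U V ^ 2) * halfTrace α β (friedrichsCos U V ^ 2) := by
      have := halfTrace_sq_sub_blockDet α β (friedrichsCos U V ^ 2)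
      rw [hd] at this
      linarith
    rw [Matrix.mulVec_sub, operator_mulVec_mulVec α β hy, Matrix.mulVec_smul, hdet]
    push_cast
    module
  · rw [hnorm]
    exact blockRadius_lt_one hα hβ hc0 (exists_eigenvector_friedrichsCos hU).1

end Main

end AAMR

theorem theorem3p1 {n : ℕ} (U V : Submodule ℝ (EuclideanSpace ℝ (Fin n)))
    (hU : U ≠ U ⊓ V) (hUV : U ⊓ V ≠ ⊥)
    (α β : ℝ) (hα : α ∈ Set.Ioc (0 : ℝ) 1) (hβ : β ∈ Set.Ioo (0 : ℝ) 1)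
    (T : Matrix (Fin n) (Fin n) ℂ) (hT : T = AAMR.toComplex (AAMR.operator U V α β))
    (θF cF : ℝ) (hθF : θF = AAMR.friedrichsAngle U V) (hcF : cF = Real.cos θF) :
    -- linear convergence with every rate in the (nonempty) interval `(γ(T), 1)`
    AAMR.gamma T < 1 ∧
    (∀ μ ∈ Set.Ioo (AAMR.gamma T) 1,
      AAMR.LinearlyConvergesTo T (AAMR.toComplex (AAMR.projMatrix (Uᗮ ⊓ Vᗮ))) μ) ∧
    -- the formula for `γ(T)`
    (cF < AAMR.cThreshold α β →
      AAMR.gamma T = 1 - 4 * α * β * (1 - β)) ∧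
    (AAMR.cThreshold α β ≤ cF → cF < AAMR.cHat β →
      AAMR.gamma T = Real.sqrt (4 * (1 - α) * α * β ^ 2 * cF ^ 2 + (1 - 2 * α * β) ^ 2)) ∧
    (AAMR.cHat β ≤ cF →
      AAMR.gamma T =
        1 + 2 * α * β * (β * cF ^ 2 - 1 + cF * Real.sqrt (β ^ 2 * cF ^ 2 - 2 * β + 1))) ∧
    -- optimality
    (AAMR.IsOptimalLinearRate T (AAMR.gamma T) ↔
      (β ≠ 1 / (1 + Real.sin θF) ∨ θF = Real.pi / 2)) := by
  have hc0 := AAMR.friedrichsCos_nonneg U V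
  have hc1 := (AAMR.exists_eigenvector_friedrichsCos hU).1
  have hθ : θF = Real.arccos (AAMR.friedrichsCos U V) := hθF
  have hcos : Real.cos θF = AAMR.friedrichsCos U V := by
    rw [hθ, Real.cos_arccos (by linarith) hc1.le]
  have hc : AAMR.friedrichsCos U V = cF := by rw [hcF, hcos]
  have hsin : 0 ≤ Real.sin θF := by
    rw [hθ, Real.sin_arccos]; exact Real.sqrt_nonneg _
  have hpi : θF = Real.pi / 2 ↔ cF = 0 := by
    rw [hθ, hc, Real.arccos_eq_pi_div_two]
  have hopt := AAMR.eq_one_div_one_add_sin_iff hβ hsin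
  rw [← hcF] at hopt
  have hγ : AAMR.gamma T = max (1 - 4 * α * β * (1 - β)) (AAMR.blockRadius α β cF) := by
    rw [hT, AAMR.gamma_operator hU hUV hα hβ, hc]
  rw [hc] at hc0 hc1
  have hr1 := AAMR.blockRadius_lt_one hα hβ hc0 hc1
  have hγ1 : AAMR.gamma T < 1 := by
    rw [hγ]; exact max_lt (AAMR.inf_eigenvalue_lt_one hα hβ) hr1
  have hκγ : 1 - 4 * α * β * (1 - β) ≤ AAMR.gamma T := hγ ▸ le_max_left _ _
  have hrγ : AAMR.blockRadius α β cF ≤ AAMR.gamma T := hγ ▸ le_max_right _ _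
  refine ⟨hγ1, ?_, ?_, ?_, ?_, ?_⟩
  · intro μ hμ
    rw [hT]
    refine AAMR.linearlyConvergesTo_operator hα hβ (hκγ.trans hμ.1.le)
      (by rw [hc]; exact hrγ.trans hμ.1.le) hμ.2 fun t ht0 htc hd => ?_
    rw [hc] at htc
    -- When the discriminant vanishes the half trace is itself a root, so `γ(T) < μ` supplies the
    -- strictness.
    have h1 : ‖((AAMR.halfTrace α β t : ℝ) : ℂ)‖ ≤ AAMR.blockRadius α β cF := by
      refine AAMR.norm_root_le_blockRadius hα hβ hc0 ht0.le htc ?_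
      have h2 := AAMR.halfTrace_sq_sub_blockDet α β t
      rw [hd, mul_zero, sub_eq_zero] at h2
      rw [← h2]
      push_cast
      ring
    rw [Complex.norm_real] at h1
    exact (Real.le_norm_self _).trans_lt ((h1.trans hrγ).trans_lt hμ.1)
  · intro h
    obtain ⟨hd, hdet⟩ := AAMR.lt_cThreshold hα hβ hc0 h
    rw [hγ, AAMR.blockRadius, if_pos hd, max_eq_left]
    exact Real.sqrt_le_iff.2 ⟨AAMR.inf_eigenvalue_nonneg hα hβ, hdet⟩
  · intro h1 h2
    rw [hγ, AAMR.blockRadius, if_pos ((AAMR.lt_cHat_iff hβ hc0).1 h2), max_eq_right]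
    · rfl
    · exact Real.le_sqrt_of_sq_le (AAMR.le_of_cThreshold_le hα hβ hc0 h1)
  · intro h
    have hd := mt (AAMR.lt_cHat_iff hβ hc0).2 h.not_gt
    rw [hγ, max_eq_right (AAMR.inf_eigenvalue_le_blockRadius hα hβ hc0 (not_lt.1 hd)),
      AAMR.blockRadius, if_neg hd]
    unfold AAMR.halfTrace AAMR.discr
    ring
  · constructor
    · intro h
      by_contra! hcon
      have hcF0 : cF ≠ 0 := mt hpi.2 hcon.2
      have hd := hopt.1 hcon.1
      have hγr : AAMR.gamma T = AAMR.blockRadius α β cF := by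
        rw [hγ, max_eq_right (AAMR.inf_eigenvalue_le_blockRadius hα hβ hc0 hd.ge)]
      have hrate : AAMR.IsLinearRate T (AAMR.gamma T) := h.1
      rw [hγr, ← hc, hT] at hrate
      exact AAMR.not_isLinearRate_of_discr_eq_zero hU hα hβ (by rwa [hc]) (by rwa [hc]) hrate
    · intro h
      refine ⟨⟨AAMR.toComplex (AAMR.projMatrix (Uᗮ ⊓ Vᗮ)), ?_⟩,
        fun ν hν => AAMR.gamma_le_of_isLinearRate hγ1 hν⟩
      have hconv := AAMR.linearlyConvergesTo_operator (U := U) (V := V) hα hβ hκγ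
        (by rw [hc]; exact hrγ) hγ1 fun t ht0 htc hd => ?_
      · rwa [← hT] at hconv
      rw [hc] at htc
      -- Only `t = c_F²` could be defective with modulus `γ(T)`; the hypothesis on `β` or `θ_F`
      -- excludes it.
      have htc' : t < cF ^ 2 := by
        refine lt_of_le_of_ne htc ?_
        rintro rfl
        rcases h with h | h
        · exact h (hopt.2 hd)
        · rw [hpi.1 h] at ht0
          simp at ht0
      exact (AAMR.halfTrace_lt_blockRadius hα hβ hc0 htc' hd).trans_le hrγ
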